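/- Let $r,s,n$ be positive integers. Work over $\mathbb{C}(q)$ with $\xi=q-q^{-1}$. Put $I_{N|N}=\{-N,\dots,-1,1,\dots,N\}$, $|i|=0$ for $i>0$ and $|i|=1$ for $i<0$; the matrix unit $E_{ij}$ has parity $|i|+|j|$, and all tensor products of superalgebras carry the usual sign rule. Let $\varphi(i,j)=(-1)^{|j|}(\delta_{i,j}+\delta_{i,-j})$ and $$S=\sum_{i,j\in I_{N|N}}q^{\varphi(i,j)}E_{ii}\otimes E_{jj}+\xi\sum_{i<j}(-1)^{|i|}(E_{ji}+E_{-j,-i})\otimes E_{ij},$$ with inverse $$S^{-1}=\sum_{i,j\in I_{N|N}}q^{-\varphi(i,j)}E_{ii}\otimes E_{jj}-\xi\sum_{i<j}(-1)^{|i|}(E_{ji}+E_{-j,-i})\otimes E_{ij}.$$ Let $\mathsf{A}_{r,n}$ be the unital associative superalgebra with generators $t_{ia}$ of parity $|i|+|a|$ ($i\in I_{r|r}$, $a\in I_{n|n}$) and relations $$t_{ia}=t_{-i,-a},\qquad S^{12}T^{1[3]}T^{2[3]}=T^{2[3]}T^{1[3]}S^{12},\qquad T=\sum_{i,a}E_{ia}\otimes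 t_{ia}.$$ Let $\bar{\mathsf{A}}_{s,n}$ be the unital associative superalgebra with generators $\bar t_{\alpha b}$ of parity $|\alpha|+|b|$ ($\alpha\in I_{s|s}$, $b\in I_{n|n}$) and relations $$\bar t_{\alpha b}=(-1)^{|\alpha|+|b|}\bar t_{-\alpha,-b},\qquad \bar T^{1[3]}\bar T^{2[3]}S^{12}=S^{12}\bar T^{2[3]}\bar T^{1[3]},\qquad \bar T=\sum_{\alpha,b}(-1)^{|b|(|\alpha|+|b|)}E_{b\alpha}\otimes\bar t_{\alpha b}.$$ Here upper indices name the tensor factors in which a matrix is placed, a bracketed index being that of its algebra coefficients, and in each relation $S$ and the identity matrices have the sizes that make the products of rectangular matrices meaningful. Put $T_+=\sum_{i=1}^{r}\sum_{a\in I_{n|n}}E_{ia}\otimes t_{ia}$. Then there is an even $\mathbb{C}(q)$-linear map $\Upsilon:\bar{\mathsf{A}}_{s,n}\otimes\mathsf{A}_{r,n}\to\mathsf{A}_{r,n}\otimes\bar{\mathsf{A}}_{s,n}$ such that 1. $\Upsilon\circ(1\otimes\mathrm{mul})=(\mathrm{mul}\otimes1)\circ(1\otimes\Upsilon)\circ(\Upsilon\otimes1)$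 on $\bar{\mathsf{A}}_{s,n}\otimes\mathsf{A}_{r,n}\otimes\mathsf{A}_{r,n}$, and $\Upsilon\circ(\mathrm{mul}\otimes1)=(1\otimes\mathrm{mul})\circ(\Upsilon\otimes1)\circ(1\otimes\Upsilon)$ on $\bar{\mathsf{A}}_{s,n}\otimes\bar{\mathsf{A}}_{s,n}\otimes\mathsf{A}_{r,n}$; 2. $\Upsilon(1\otimes f)=f\otimes1$ and $\Upsilon(\bar g\otimes1)=1\otimes\bar g$ for all $f\in\mathsf{A}_{r,n}$, $\bar g\in\bar{\mathsf{A}}_{s,n}$; 3. $\Upsilon\big(\bar T^{1[3]}T_+^{2[4]}\big)=T_+^{2[3]}(S^{-1})^{12}\,\bar T^{1[4]}$, where $\Upsilon$ is applied to the coefficients; 4. the composition $(\mathrm{mul}\otimes\mathrm{mul})\circ(\mathrm{id}\otimes\Upsilon\otimes\mathrm{id})$ is an associative multiplication on $\mathcal{O}_{r,s}=\mathsf{A}_{r,n}\otimes\bar{\mathsf{A}}_{s,n}$ with unit $1\otimes1$. -/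

import Mathlib

open scoped TensorProduct

noncomputable section

namespace QueerSuper

/-! ### Base field, indices and parities -/

/-- The base field `ℂ(q)`. -/
abbrev K : Type := RatFunc ℂ

/-- The indeterminate `q`. -/
def q : K := RatFunc.X

/-- `ξ = q - q⁻¹`. -/
def ξ : K := q - q⁻¹

/-- `I_{N|N} = {-N, …, -1, 1, …, N}`. -/
abbrev I (N : ℕ) : Type := {i : ℤ // i ∈ (Finset.Icc (-(N : ℤ)) N).erase 0}

/-- The positive indices `{1, …, N}` inside `I_{N|N}`. -/
abbrev IPos (N : ℕ) : Type := {i : I N // 0 < i.1}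

/-- The index `-i`. -/
def opp {N : ℕ} (i : I N) : I N :=
  ⟨-i.1, by
    have h := i.2
    simp only [Finset.mem_erase, Finset.mem_Icc] at h ⊢
    omega⟩

/-- Index types of homogeneous bases; `par i` is `0` for an even and `1` for an odd index. -/
class HasParity (ι : Type) where
  par : ι → ℕ

/-- The parity `|i|` of an index. -/
def par {ι : Type} [HasParity ι] (i : ι) : ℕ := HasParity.par i

instance instParityI (N : ℕ) : HasParity (I N) := ⟨fun i => if 0 < i.1 then 0 else 1⟩

instance instParityIPos (N : ℕ) : HasParity (IPos N) := ⟨fun i => par i.1⟩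

/-! ### Supermatrices

An element `∑ E_{ia} ⊗ x_{ia}` of `Hom ⊗ B` is stored as the matrix `(x_{ia})`, and an element
`∑ E_{ik} ⊗ E_{jl} ⊗ x` of `Hom ⊗ Hom ⊗ B` as the matrix whose entry at row `(i, j)` and column
`(k, l)` is the coefficient `x` of `E_{ik} ⊗ E_{jl}`. -/

section Supermatrix

variable {I₁ I₂ J₁ J₂ L₁ L₂ : Type}

/-- `X^{1[3]} = ∑ E_{ia} ⊗ 1 ⊗ x_{ia}`, the second tensor factor having a basis indexed by `L₁`. -/
def leg1 {B : Type} [Zero B] [DecidableEq L₁] (X : Matrix I₁ J₁ B) :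
    Matrix (I₁ × L₁) (J₁ × L₁) B :=
  fun u v => if u.2 = v.2 then X u.1 v.1 else 0

/-- `X^{2[3]} = ∑ 1 ⊗ E_{ia} ⊗ x_{ia}`, the first tensor factor having a basis indexed by `L₁`. -/
def leg2 {B : Type} [Zero B] [DecidableEq L₁] (X : Matrix I₁ J₁ B) :
    Matrix (L₁ × I₁) (L₁ × J₁) B :=
  fun u v => if u.1 = v.1 then X u.2 v.2 else 0

variable [HasParity I₁] [HasParity I₂] [HasParity J₁] [HasParity J₂] [HasParity L₁]
  [HasParity L₂] [Fintype J₁] [Fintype J₂]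

/-- Product of two even supermatrices, the coefficients being multiplied by the bilinear map `β`.
By the sign rule for graded tensor products,
`(E_{ik} ⊗ E_{jl} ⊗ x) (E_{km} ⊗ E_{lp} ⊗ y) = ± E_{im} ⊗ E_{jp} ⊗ β x y` with exponent
`|E_{jl}| |E_{km}| + |x| (|E_{km}| + |E_{lp}|)`. All supermatrices to which this is applied are
even, that is `|x| = |E_{ik}| + |E_{jl}|`, and this is how `|x|` enters. -/
def superMul {B C D : Type} [AddCommMonoid B] [Module K B] [AddCommMonoid C] [Module K C]
    [AddCommMonoid D] [Module K D] (β : B →ₗ[K] C →ₗ[K] D)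
    (X : Matrix (I₁ × I₂) (J₁ × J₂) B) (Y : Matrix (J₁ × J₂) (L₁ × L₂) C) :
    Matrix (I₁ × I₂) (L₁ × L₂) D :=
  fun u w => ∑ v : J₁ × J₂,
    (-1 : K) ^ ((par u.2 + par v.2) * (par v.1 + par w.1) +
      (par u.1 + par v.1 + par u.2 + par v.2) * (par v.1 + par w.1 + par v.2 + par w.2)) •
        β (X u v) (Y v w)

/-- Product of even supermatrices with coefficients in the same algebra. -/
def mulM {B : Type} [Semiring B] [Algebra K B]
    (X : Matrix (I₁ × I₂) (J₁ × J₂) B) (Y : Matrix (J₁ × J₂) (L₁ × L₂) B) :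
    Matrix (I₁ × I₂) (L₁ × L₂) B :=
  superMul (LinearMap.mul K B) X Y

/-- Product of a scalar even supermatrix with an even supermatrix. -/
def lscal {B : Type} [AddCommMonoid B] [Module K B]
    (X : Matrix (I₁ × I₂) (J₁ × J₂) K) (Y : Matrix (J₁ × J₂) (L₁ × L₂) B) :
    Matrix (I₁ × I₂) (L₁ × L₂) B :=
  superMul (LinearMap.lsmul K B) X Y

/-- Product of an even supermatrix with a scalar even supermatrix. -/
def rscal {B : Type} [AddCommMonoid B] [Module K B]
    (X : Matrix (I₁ × I₂) (J₁ × J₂) B) (Y : Matrix (J₁ × J₂) (L₁ × L₂) K) :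
    Matrix (I₁ × I₂) (L₁ × L₂) B :=
  superMul (LinearMap.lsmul K B).flip X Y

/-- Product of an even supermatrix over `B` with one over `C`, with coefficients `x ⊗ y`. -/
def tmulM {B C : Type} [AddCommMonoid B] [Module K B] [AddCommMonoid C] [Module K C]
    (X : Matrix (I₁ × I₂) (J₁ × J₂) B) (Y : Matrix (J₁ × J₂) (L₁ × L₂) C) :
    Matrix (I₁ × I₂) (L₁ × L₂) (B ⊗[K] C) :=
  superMul (TensorProduct.mk K B C) X Y

end Supermatrix

/-! ### The matrix `S` -/

/-- `φ(i, j) = (-1)^{|j|} (δ_{i,j} + δ_{i,-j})`. -/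
def φ {N : ℕ} (i j : I N) : ℤ :=
  (-1) ^ par j * ((if i = j then 1 else 0) + (if i = opp j then 1 else 0))

/-- The element `E_{ik} ⊗ E_{jl}`. -/
def E {N : ℕ} (i k j l : I N) : Matrix (I N × I N) (I N × I N) K :=
  Matrix.single (i, j) (k, l) 1

/-- `S = ∑ q^{φ(i,j)} E_{ii} ⊗ E_{jj} + ξ ∑_{i<j} (-1)^{|i|} (E_{ji} + E_{-j,-i}) ⊗ E_{ij}`. -/
def S (N : ℕ) : Matrix (I N × I N) (I N × I N) K :=
  (∑ i : I N, ∑ j : I N, q ^ φ i j • E i i j j) +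
    ξ • ∑ i : I N, ∑ j : I N,
      if i < j then (-1 : K) ^ par i • (E j i i j + E (opp j) (opp i) i j) else 0

/-- The inverse of `S`, given by
`∑ q^{-φ(i,j)} E_{ii} ⊗ E_{jj} - ξ ∑_{i<j} (-1)^{|i|} (E_{ji} + E_{-j,-i}) ⊗ E_{ij}`. -/
def Sinv (N : ℕ) : Matrix (I N × I N) (I N × I N) K :=
  (∑ i : I N, ∑ j : I N, q ^ (-φ i j) • E i i j j) -
    ξ • ∑ i : I N, ∑ j : I N,
      if i < j then (-1 : K) ^ par i • (E j i i j + E (opp j) (opp i) i j) else 0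

/-! ### The quantum coordinate superalgebra `A_{r,n}` -/

/-- The matrix `T = ∑ E_{ia} ⊗ t_{ia}` over the free superalgebra. -/
def freeT (r n : ℕ) : Matrix (I r) (I n) (FreeAlgebra K (I r × I n)) :=
  fun i a => FreeAlgebra.ι K (i, a)

/-- The defining relations `t_{ia} = t_{-i,-a}` and
`S^{12} T^{1[3]} T^{2[3]} = T^{2[3]} T^{1[3]} S^{12}` of `A_{r,n}`. -/
inductive ARel (r n : ℕ) : FreeAlgebra K (I r × I n) → FreeAlgebra K (I r × I n) → Prop
  | opp (i : I r) (a : I n) : ARel r n (freeT r n i a) (freeT r n (opp i) (opp a))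
  | rtt (u : I r × I r) (v : I n × I n) : ARel r n
      (mulM (lscal (S r) (leg1 (L₁ := I r) (freeT r n))) (leg2 (L₁ := I n) (freeT r n)) u v)
      (rscal (mulM (leg2 (L₁ := I r) (freeT r n)) (leg1 (L₁ := I n) (freeT r n))) (S n) u v)

/-- The quantum coordinate superalgebra `A_{r,n}`. -/
abbrev A (r n : ℕ) : Type := RingQuot (ARel r n)

/-- The generators `t_{ia}`, arranged as the matrix `T`. -/
def T (r n : ℕ) : Matrix (I r) (I n) (A r n) :=
  fun i a => RingQuot.mkAlgHom K (ARel r n) (FreeAlgebra.ι K (i, a))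

/-- `T_+ = ∑_{i=1}^{r} ∑_a E_{ia} ⊗ t_{ia}`. -/
def Tplus (r n : ℕ) : Matrix (IPos r) (I n) (A r n) :=
  fun i a => T r n i.1 a

/-! ### The dual quantum coordinate superalgebra `Ā_{s,n}` -/

/-- The matrix `T̄ = ∑ (-1)^{|b|(|α|+|b|)} E_{bα} ⊗ t̄_{αb}` over the free superalgebra. -/
def freeTbar (s n : ℕ) : Matrix (I n) (I s) (FreeAlgebra K (I s × I n)) :=
  fun b α => (-1 : K) ^ (par b * (par α + par b)) • FreeAlgebra.ι K (α, b)

/-- The defining relations `t̄_{αb} = (-1)^{|α|+|b|} t̄_{-α,-b}` and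
`T̄^{1[3]} T̄^{2[3]} S^{12} = S^{12} T̄^{2[3]} T̄^{1[3]}` of `Ā_{s,n}`. -/
inductive AbarRel (s n : ℕ) : FreeAlgebra K (I s × I n) → FreeAlgebra K (I s × I n) → Prop
  | opp (α : I s) (b : I n) : AbarRel s n (FreeAlgebra.ι K (α, b))
      ((-1 : K) ^ (par α + par b) • FreeAlgebra.ι K (opp α, opp b))
  | rtt (u : I n × I n) (v : I s × I s) : AbarRel s n
      (rscal (mulM (leg1 (L₁ := I n) (freeTbar s n)) (leg2 (L₁ := I s) (freeTbar s n))) (S s) u v)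
      (mulM (lscal (S n) (leg2 (L₁ := I n) (freeTbar s n))) (leg1 (L₁ := I s) (freeTbar s n)) u v)

/-- The dual quantum coordinate superalgebra `Ā_{s,n}`. -/
abbrev Abar (s n : ℕ) : Type := RingQuot (AbarRel s n)

/-- The generators `t̄_{αb}`. -/
def tbar (s n : ℕ) (α : I s) (b : I n) : Abar s n :=
  RingQuot.mkAlgHom K (AbarRel s n) (FreeAlgebra.ι K (α, b))

/-- `T̄ = ∑ (-1)^{|b|(|α|+|b|)} E_{bα} ⊗ t̄_{αb}`. -/
def Tbar (s n : ℕ) : Matrix (I n) (I s) (Abar s n) :=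
  fun b α => (-1 : K) ^ (par b * (par α + par b)) • tbar s n α b

/-! ### The parity gradings -/

/-- The part of parity `ε` of `A_{r,n}`: the span of the monomials in the generators `t_{ia}`, of
parity `|i| + |a|`, that have total parity `ε`. -/
def gradeA (r n : ℕ) (ε : ZMod 2) : Submodule K (A r n) :=
  Submodule.span K {x | ∃ w : List (I r × I n),
    (w.map fun p => ((par p.1 + par p.2 : ℕ) : ZMod 2)).sum = ε ∧
      (w.map fun p => T r n p.1 p.2).prod = x}

/-- The part of parity `ε` of `Ā_{s,n}`. -/
def gradeAbar (s n : ℕ) (ε : ZMod 2) : Submodule K (Abar s n) :=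
  Submodule.span K {x | ∃ w : List (I s × I n),
    (w.map fun p => ((par p.1 + par p.2 : ℕ) : ZMod 2)).sum = ε ∧
      (w.map fun p => tbar s n p.1 p.2).prod = x}

/-- The part of parity `ε` of the tensor product of two graded spaces. -/
def gradeTensor {B C : Type} [AddCommMonoid B] [Module K B] [AddCommMonoid C] [Module K C]
    (P : ZMod 2 → Submodule K B) (Q : ZMod 2 → Submodule K C) (ε : ZMod 2) :
    Submodule K (B ⊗[K] C) :=
  Submodule.span K {z | ∃ δ η : ZMod 2, δ + η = ε ∧ ∃ x ∈ P δ, ∃ y ∈ Q η, x ⊗ₜ[K] y = z}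

/-! ### The associativity diagrams and the braided multiplication -/

section Braided

variable {B C : Type} [Semiring B] [Algebra K B] [Semiring C] [Algebra K C]

/-- `Υ ∘ (1 ⊗ mul) = (mul ⊗ 1) ∘ (1 ⊗ Υ) ∘ (Υ ⊗ 1)` on `C ⊗ B ⊗ B`. -/
def Diagram1 (Υ : C ⊗[K] B →ₗ[K] B ⊗[K] C) : Prop :=
  Υ ∘ₗ (LinearMap.mul' K B).lTensor C =
    (LinearMap.mul' K B).rTensor C ∘ₗ (TensorProduct.assoc K B B C).symm.toLinearMap ∘ₗ
      Υ.lTensor B ∘ₗ (TensorProduct.assoc K B C B).toLinearMap ∘ₗ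
        Υ.rTensor B ∘ₗ (TensorProduct.assoc K C B B).symm.toLinearMap

/-- `Υ ∘ (mul ⊗ 1) = (1 ⊗ mul) ∘ (Υ ⊗ 1) ∘ (1 ⊗ Υ)` on `C ⊗ C ⊗ B`. -/
def Diagram2 (Υ : C ⊗[K] B →ₗ[K] B ⊗[K] C) : Prop :=
  Υ ∘ₗ (LinearMap.mul' K C).rTensor B =
    (LinearMap.mul' K C).lTensor B ∘ₗ (TensorProduct.assoc K B C C).toLinearMap ∘ₗ
      Υ.rTensor C ∘ₗ (TensorProduct.assoc K C B C).symm.toLinearMap ∘ₗ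
        Υ.lTensor C ∘ₗ (TensorProduct.assoc K C C B).toLinearMap

/-- The multiplication `(mul ⊗ mul) ∘ (id ⊗ Υ ⊗ id)` on `B ⊗ C`. -/
def braidedMul (Υ : C ⊗[K] B →ₗ[K] B ⊗[K] C) :
    (B ⊗[K] C) ⊗[K] (B ⊗[K] C) →ₗ[K] B ⊗[K] C :=
  TensorProduct.map (LinearMap.mul' K B) (LinearMap.mul' K C) ∘ₗ
    (TensorProduct.assoc K B B (C ⊗[K] C)).symm.toLinearMap ∘ₗ
      ((TensorProduct.assoc K B C C).toLinearMap ∘ₗ Υ.rTensor C ∘ₗ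
        (TensorProduct.assoc K C B C).symm.toLinearMap).lTensor B ∘ₗ
          (TensorProduct.assoc K B C (B ⊗[K] C)).toLinearMap

end Braided

end QueerSuper

end

/-!
A sign twist of the entries turns super matrix products into ordinary ones, and `S` followed by the
graded flip becomes an ordinary matrix `R`. In this form the defining relations read
`R T₁ T₂ = T₁ T₂ R` and `R T̄₂ T̄₁ = T̄₂ T̄₁ R`, with signs absorbed in the products. The matrix `R`
satisfies the Hecke relation `R² = 1 + ξ R` and the braid relation. The index negations act by
signed permutations which intertwine the difference of the two sides of such an identity, so it only
has to be checked on rows with positive indices, where `R` takes the familiar type A form.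

To construct `Υ`, let `Ā` act on `A ⊗ Ā` so as to extend left multiplication on the second factor.
The exchange relation between `T̄` and `T₊` prescribes, for every column `α` of `T̄`, an algebra
homomorphism from `A` to matrices over `A`, with structure constants the entries of `R⁻¹`. The braid
relation makes it compatible with the relations of `A`, and also shows that `R` commutes with the
twofold composites of these homomorphisms, so that the relations of `Ā` hold for the resulting
operators. Now `Υ (c ⊗ f)` is the image of `f ⊗ 1` under the action of `c`. Compatibility of `Υ`
with the product of `Ā` is multiplicativity of the action; compatibility with the product of `A`
follows because the exchange homomorphisms are multiplicative and the entries of `T̄` generate `Ā`.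
Associativity is a formal consequence of the two.
-/

noncomputable section

namespace QueerSuper

open scoped Matrix

/-! ### Signs and indices -/

/-- The parity `|i|` of an index as an element of `ℤ/2`, so that signs depend on it additively. -/
def pr {ι : Type} [HasParity ι] (i : ι) : ZMod 2 := (par i : ZMod 2)

/-- The sign `(-1)^x`. -/
def sg (x : ZMod 2) : K := if x = 0 then 1 else -1

@[simp] theorem sg_zero : sg 0 = 1 := if_pos rfl

@[simp] theorem sg_one : sg 1 = -1 := if_neg one_ne_zero

theorem zmod_two_cases : ∀ x : ZMod 2, x = 0 ∨ x = 1 := by decide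

theorem sg_add (x y : ZMod 2) : sg (x + y) = sg x * sg y := by
  rcases zmod_two_cases x with rfl | rfl <;> rcases zmod_two_cases y with rfl | rfl <;>
    simp [CharTwo.add_self_eq_zero]

theorem sg_mul_self (x : ZMod 2) : sg x * sg x = 1 := by
  rw [← sg_add, CharTwo.add_self_eq_zero, sg_zero]

theorem neg_one_pow_eq_sg (m : ℕ) : (-1 : K) ^ m = sg m := by
  induction m with
  | zero => simp
  | succ m ih => rw [pow_succ, ih, Nat.cast_succ, sg_add, sg_one]

@[simp] theorem cast_par {ι : Type} [HasParity ι] (i : ι) : ((par i : ℕ) : ZMod 2) = pr i := rfl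

section Index
variable {N : ℕ}

theorem val_ne_zero (i : I N) : i.1 ≠ 0 := (Finset.mem_erase.1 i.2).1

@[simp] theorem opp_val (i : I N) : (opp i).1 = -i.1 := rfl

@[simp] theorem opp_opp (i : I N) : opp (opp i) = i := Subtype.ext (neg_neg _)

/-- Negation of indices as a permutation. -/
def oppEquiv (N : ℕ) : Equiv.Perm (I N) := ⟨opp, opp, opp_opp, opp_opp⟩

@[simp] theorem oppEquiv_apply (i : I N) : oppEquiv N i = opp i := rfl

theorem opp_eq_iff (i j : I N) : opp i = j ↔ i = opp j := ((oppEquiv N).eq_symm_apply).symm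

theorem ne_opp_self (i : I N) : i ≠ opp i := fun h => by
  have := congrArg Subtype.val h
  have := val_ne_zero i
  rw [opp_val] at *
  omega

theorem pos_or_opp_pos (i : I N) : 0 < i.1 ∨ 0 < (opp i).1 := by
  have := val_ne_zero i
  rw [opp_val]
  omega

theorem pr_eq (i : I N) : pr i = if 0 < i.1 then 0 else 1 := by
  simp only [pr, par, HasParity.par]
  split_ifs <;> simp

theorem pr_of_pos {i : I N} (h : 0 < i.1) : pr i = 0 := by rw [pr_eq, if_pos h]

@[simp] theorem pr_opp (i : I N) : pr (opp i) = pr i + 1 := by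
  have := val_ne_zero i
  rw [pr_eq, pr_eq, opp_val]
  split_ifs <;> first | omega | decide

end Index

/-! ### Signed permutation matrices -/

section SignedPerm
variable {ι κ : Type} [Fintype ι] [DecidableEq ι]

/-- The signed permutation matrix with entry `(-1)^{s u}` in row `u` and column `σ u`. -/
def signedPerm (s : ι → ZMod 2) (σ : Equiv.Perm ι) : Matrix ι ι K :=
  Matrix.of fun u v => if v = σ u then sg (s u) else 0

theorem signedPerm_mulVec (s : ι → ZMod 2) (σ : Equiv.Perm ι) (f : ι → K) :
    signedPerm s σ *ᵥ f = fun u => sg (s u) * f (σ u) := by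
  funext u
  simp [signedPerm, Matrix.mulVec, dotProduct]

/-- Extension of scalars from `K` to a `K`-algebra for square matrices. -/
def baseChange (B : Type) [Semiring B] [Algebra K B] : Matrix ι ι K →ₐ[K] Matrix ι ι B :=
  (Algebra.ofId K B).mapMatrix

variable {B : Type} [Semiring B] [Algebra K B]

theorem baseChange_mul_apply (P : Matrix ι ι K) (W : Matrix ι κ B) (u : ι) (v : κ) :
    (baseChange B P * W) u v = ∑ x, P u x • W x v := by
  simp [baseChange, Algebra.ofId_apply, Matrix.mul_apply, Algebra.smul_def]

theorem mul_baseChange_apply (W : Matrix κ ι B) (P : Matrix ι ι K) (u : κ) (v : ι) :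
    (W * baseChange B P) u v = ∑ x, P x v • W u x := by
  simp [baseChange, Algebra.ofId_apply, Matrix.mul_apply, Algebra.smul_def, Algebra.commutes]

theorem signedPerm_mul_apply (s : ι → ZMod 2) (σ : Equiv.Perm ι) (W : Matrix ι κ B) (u : ι)
    (v : κ) : (baseChange B (signedPerm s σ) * W) u v = sg (s u) • W (σ u) v := by
  simp [baseChange_mul_apply, signedPerm]

theorem mul_signedPerm_apply (W : Matrix κ ι B) (s : ι → ZMod 2) (σ : Equiv.Perm ι) (u : κ)
    (v : ι) : (W * baseChange B (signedPerm s σ)) u v =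
      sg (s (σ.symm v)) • W u (σ.symm v) := by
  simp [mul_baseChange_apply, signedPerm, ← σ.symm_apply_eq]

theorem row_eq_zero_of_signedPerm_mul {s : ι → ZMod 2} {σ : Equiv.Perm ι} [Fintype κ]
    {W : Matrix ι κ B} {Q : Matrix κ κ B} (hW : baseChange B (signedPerm s σ) * W = W * Q)
    {u : ι} (hu : W u = 0) : W (σ u) = 0 := by
  have h : sg (s u) • W (σ u) = 0 := by
    ext v
    rw [Pi.smul_apply, ← signedPerm_mul_apply, hW, Matrix.mul_apply_eq_vecMul, hu,
      Matrix.zero_vecMul]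
  simpa [smul_smul, sg_mul_self] using congrArg (sg (s u) • ·) h

end SignedPerm

/-! ### The Hecke matrix `R` -/

theorem q_ne_zero : q ≠ 0 := RatFunc.X_ne_zero

section Hecke
variable {N : ℕ}

/-- The coefficient of `E_{ij} ⊗ E_{ji}` in `R`. -/
def weight (i j : I N) : K := sg (pr i * pr j) * q ^ φ j i

/-- The composition of `S` with the graded flip, as an ordinary matrix: the odd analogue of the
Hecke type `R`-matrix of `GL_N`. -/
def R (N : ℕ) : Matrix (I N × I N) (I N × I N) K := Matrix.of fun u v =>
  (if v = u.swap then weight u.1 u.2 else 0) +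
    (if v = u then if u.1 < u.2 then ξ else 0 else 0) -
    (if v = (opp u.1, opp u.2) then if u.1 < opp u.2 then ξ * sg (pr u.2) else 0 else 0)

/-- The inverse of `R`, in the form given by the Hecke relation. -/
def Rinv (N : ℕ) : Matrix (I N × I N) (I N × I N) K := R N - ξ • 1

theorem R_mulVec (f : I N × I N → K) (i j : I N) :
    (R N *ᵥ f) (i, j) = weight i j * f (j, i) + (if i < j then ξ else 0) * f (i, j) -
      (if i < opp j then ξ * sg (pr j) else 0) * f (opp i, opp j) := by
  simp [R, Matrix.mulVec, dotProduct, sub_mul, add_mul, Finset.sum_sub_distrib,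
    Finset.sum_add_distrib]

theorem φ_opp_left (i j : I N) : φ (opp i) j = φ i j := by
  simp only [φ, opp_eq_iff, opp_opp]
  rw [add_comm]

theorem φ_of_ne {i j : I N} (h : i ≠ j) (h' : i ≠ opp j) : φ i j = 0 := by simp [φ, h, h']

theorem φ_self (i : I N) : φ i i = (-1) ^ par i := by simp [φ, ne_opp_self]

theorem weight_opp_right (i j : I N) : weight i (opp j) = sg (pr i) * weight i j := by
  rw [weight, weight, φ_opp_left, pr_opp, mul_add, mul_one, sg_add]
  ring

theorem φ_opp_right (i j : I N) : φ i (opp j) = -φ i j := by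
  have hpar : (-1 : ℤ) ^ par (opp j) = -(-1) ^ par j := by
    rcases (val_ne_zero j).lt_or_gt with h | h <;> simp [par, HasParity.par, h, h.not_gt]
  rw [φ, φ, hpar, opp_opp, add_comm, neg_mul]

theorem φ_swap {i j : I N} (h : i ≠ j) : φ j i = -φ i j := by
  by_cases h' : i = opp j
  · rw [h', φ_opp_right, φ_opp_left]
  · rw [φ_of_ne h h', φ_of_ne h.symm fun e => h' ((opp_eq_iff _ _).1 e.symm), neg_zero]

theorem weight_mul_swap {i j : I N} (h : i ≠ j) : weight i j * weight j i = 1 := by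
  rw [weight, weight, mul_mul_mul_comm, mul_comm (pr j), sg_mul_self, one_mul,
    ← zpow_add₀ q_ne_zero, φ_swap h, neg_add_cancel, zpow_zero]

theorem weight_self (i : I N) : weight i i = if 0 < i.1 then q else -q⁻¹ := by
  simp only [weight, φ_self, pr, par, HasParity.par]
  split_ifs <;> simp

theorem weight_opp_opp {i j : I N} (h : i ≠ j) (h' : i ≠ opp j) :
    sg (pr j) * weight (opp i) (opp j) = -(sg (pr i) * weight i j) := by
  have h'' : j ≠ opp i := fun e => h' ((opp_eq_iff _ _).1 e.symm)
  rw [weight_opp_right, weight, weight, φ_opp_right, φ_of_ne h.symm h'', pr_opp, add_mul, one_mul,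
    sg_add, sg_add, neg_zero, zpow_zero, sg_one]
  linear_combination -sg (pr i) * sg (pr i * pr j) * sg_mul_self (pr j)

theorem opp_lt_opp {i j : I N} : opp i < opp j ↔ j < i := by
  simp only [← Subtype.coe_lt_coe, opp_val, neg_lt_neg_iff]

theorem R_mul_self (N : ℕ) : R N * R N = ξ • R N + 1 := by
  refine Matrix.mulVec_injective (funext fun f => funext fun ⟨i, j⟩ => ?_)
  rw [← Matrix.mulVec_mulVec, Matrix.add_mulVec, Matrix.smul_mulVec, Matrix.one_mulVec]
  simp only [R_mulVec, Pi.add_apply, Pi.smul_apply, smul_eq_mul, opp_opp, pr_opp, sg_add, sg_one]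
  have hlt : opp i < j ↔ opp j < i := by rw [← opp_lt_opp, opp_opp]
  have hlt' : j < opp i ↔ i < opp j := by rw [← opp_lt_opp, opp_opp]
  rcases eq_or_ne i j with rfl | hij
  · simp only [lt_self_iff_false, if_false, weight_self]
    have hq := mul_inv_cancel₀ q_ne_zero
    rcases pos_or_opp_pos i with h | h
    · have h' : ¬ 0 < (opp i).1 := by rw [opp_val]; omega
      have hi : ¬ i < opp i := by rw [← Subtype.coe_lt_coe]; omega
      simp only [h, h', hi, if_true, if_false, ξ]
      grind
    · have h' : ¬ 0 < i.1 := by rw [opp_val] at h; omega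
      have hi : i < opp i := by rw [← Subtype.coe_lt_coe]; omega
      have := sg_mul_self (pr i)
      simp only [h, h', hi, hi.not_gt, if_true, if_false, ξ]
      grind
  rcases eq_or_ne i (opp j) with rfl | hij'
  · simp only [opp_opp, lt_self_iff_false, if_false]
    have := weight_mul_swap hij
    rcases hij.lt_or_gt with h | h <;> simp only [h, h.not_gt, if_true, if_false] <;> grind
  have := weight_mul_swap hij
  have := weight_opp_opp hij hij'
  have := sg_mul_self (pr j)
  simp only [hlt, hlt', opp_lt_opp]
  rcases hij.lt_or_gt with h | h <;> rcases hij'.lt_or_gt with h' | h' <;>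
    simp only [h, h.not_gt, h', h'.not_gt, if_true, if_false] <;> grind

/-- Negation of the first index, with its sign. -/
def J₁ (N : ℕ) : Matrix (I N × I N) (I N × I N) K :=
  signedPerm (fun u => pr u.1) ((oppEquiv N).prodCongr 1)

/-- Negation of the second index, with its sign. -/
def J₂ (N : ℕ) : Matrix (I N × I N) (I N × I N) K :=
  signedPerm (fun u => pr u.1 + pr u.2) (Equiv.prodCongr 1 (oppEquiv N))

theorem J₂_mul_R (N : ℕ) : J₂ N * R N = R N * J₁ N := by
  refine Matrix.mulVec_injective (funext fun f => funext fun ⟨i, j⟩ => ?_)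
  simp only [← Matrix.mulVec_mulVec, J₁, J₂, signedPerm_mulVec, R_mulVec, Equiv.prodCongr_apply,
    Prod.map, Equiv.Perm.one_apply, oppEquiv_apply, opp_opp, pr_opp, weight_opp_right, sg_add,
    sg_one]
  have := sg_mul_self (pr i)
  have := sg_mul_self (pr j)
  grind

end Hecke

section Ring
variable {k A : Type*} [CommRing k] [Ring A] [Algebra k A] {ξ : k} {x y a b c : A}

theorem intertwine_of_hecke (hx : x * x = ξ • x + 1) (h : b * x = x * a) :
    a * x = x * b - ξ • b + ξ • a := by
  have hxbx : a = x * b * x - ξ • (x * a) := by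
    rw [mul_assoc, h, ← mul_assoc, hx, add_mul, one_mul, smul_mul_assoc, add_sub_cancel_left]
  have hxax : x * a * x = ξ • (x * a) + b := by
    rw [← h, mul_assoc, hx, mul_add, mul_one, mul_smul_comm]
  calc a * x = x * (b * (x * x)) - ξ • (x * a * x) := by
        conv_lhs => rw [hxbx]
        rw [sub_mul, smul_mul_assoc]
        simp only [mul_assoc]
    _ = x * b - ξ • b + ξ • (x * b * x - ξ • (x * a)) := by
        rw [hx, hxax]
        simp only [mul_add, mul_one, mul_smul_comm, smul_sub, smul_add, mul_assoc]
        abel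
    _ = _ := by rw [← hxbx]

theorem braid_defect_intertwine (hx : x * x = ξ • x + 1) (hy : y * y = ξ • y + 1)
    (hbx : b * x = x * a) (hcx : c * x = x * c) (hcy : c * y = y * b) (hay : a * y = y * a) :
    c * (x * y * x - y * x * y) = (x * y * x - y * x * y) * a ∧
      b * (x * y * x - y * x * y) = (x * y * x - y * x * y) * b ∧
      a * (x * y * x - y * x * y) = (x * y * x - y * x * y) * c := by
  have hax := intertwine_of_hecke hx hbx
  have hby := intertwine_of_hecke hy hcy
  refine ⟨?_, ?_, ?_⟩
  · linear_combination (norm := noncomm_ring)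
      hcx * y * x + x * hcy * x + x * y * hbx - hcy * x * y - y * hbx * y - y * x * hay
  · linear_combination (norm := (noncomm_ring; module))
      hbx * y * x + x * hay * x + x * y * hax - hby * x * y - y * hcx * y - y * x * hcy +
        ξ • (hcx * y + x * hcy - hbx * y - x * hay)
  · linear_combination (norm := (noncomm_ring; module))
      hax * y * x + x * hby * x + x * y * hcx - hay * x * y - y * hax * y - y * x * hby +
        ξ • (hay * x - hby * x - x * hcx + x * hbx - y * hcx + y * hax + y * hby - y * hay) +
        ξ • ξ • (hcx - hbx) + ξ • ((hy - hx) * (c - a))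

end Ring

section Reduction
variable {M N : ℕ}

theorem J₁_mul_R (N : ℕ) : J₁ N * R N = R N * J₂ N - ξ • J₂ N + ξ • J₁ N :=
  intertwine_of_hecke (R_mul_self N) (J₂_mul_R N)

theorem J₁_mul_Rinv (N : ℕ) : J₁ N * Rinv N = Rinv N * J₂ N := by
  simp [Rinv, mul_sub, sub_mul, J₁_mul_R]

theorem R_mul_Rinv (N : ℕ) : R N * Rinv N = 1 := by simp [Rinv, mul_sub, R_mul_self]

theorem Rinv_mul_R (N : ℕ) : Rinv N * R N = 1 := by simp [Rinv, sub_mul, R_mul_self]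

theorem R_mul_eq_mul_R_of_pos {B : Type} [Ring B] [Algebra K B]
    {W : Matrix (I M × I M) (I N × I N) B}
    (h₁ : baseChange B (J₁ M) * W = W * baseChange B (J₁ N))
    (h₂ : baseChange B (J₂ M) * W = W * baseChange B (J₂ N))
    (hpos : ∀ i j : I M, 0 < i.1 → 0 < j.1 →
      (baseChange B (R M) * W) (i, j) = (W * baseChange B (R N)) (i, j)) :
    baseChange B (R M) * W = W * baseChange B (R N) := by
  let D := baseChange B (R M) * W - W * baseChange B (R N)
  have hD₁ : baseChange B (J₁ M) * D = D * baseChange B (J₂ N) := by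
    have hM := congrArg (baseChange B · * W) (J₁_mul_R M)
    have hN := congrArg (W * baseChange B ·) (J₁_mul_R N)
    simp only [map_add, map_sub, map_mul, map_smul, Matrix.add_mul, Matrix.sub_mul, Matrix.mul_add,
      Matrix.mul_sub, Matrix.smul_mul, Matrix.mul_smul, Matrix.mul_assoc, h₁, h₂] at hM hN
    simp only [D, Matrix.mul_sub, Matrix.sub_mul, hM, ← Matrix.mul_assoc, h₁]
    simp only [Matrix.mul_assoc, hN]
    abel
  have hD₂ : baseChange B (J₂ M) * D = D * baseChange B (J₁ N) := by
    simp only [D, Matrix.mul_sub, Matrix.sub_mul]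
    rw [← Matrix.mul_assoc, ← Matrix.mul_assoc, ← map_mul, J₂_mul_R, h₂, Matrix.mul_assoc W,
      ← map_mul, J₂_mul_R, map_mul, map_mul]
    simp only [Matrix.mul_assoc, h₁]
  have hneg : ∀ {i j : I M}, 0 < i.1 → D (i, j) = 0 := by
    intro i j hi
    rcases pos_or_opp_pos j with hj | hj
    · exact sub_eq_zero.2 (hpos i j hi hj)
    · simpa using row_eq_zero_of_signedPerm_mul hD₂ (sub_eq_zero.2 (hpos i _ hi hj))
  refine sub_eq_zero.1 (funext fun ⟨i, j⟩ => ?_)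
  rcases pos_or_opp_pos i with hi | hi
  · exact hneg hi
  · exact (by simpa using row_eq_zero_of_signedPerm_mul hD₁ (hneg (j := j) hi) : D (i, j) = 0)

end Reduction

section Legs
variable {ι : Type} [DecidableEq ι]

/-- The matrix `M ⊗ 1` on a triple tensor product. -/
def leg12 (M : Matrix (ι × ι) (ι × ι) K) : Matrix (ι × ι × ι) (ι × ι × ι) K :=
  Matrix.of fun u v => if v.2.2 = u.2.2 then M (u.1, u.2.1) (v.1, v.2.1) else 0

/-- The matrix `1 ⊗ M` on a triple tensor product. -/
def leg23 (M : Matrix (ι × ι) (ι × ι) K) : Matrix (ι × ι × ι) (ι × ι × ι) K :=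
  Matrix.of fun u v => if v.1 = u.1 then M u.2 v.2 else 0

theorem leg12_one : leg12 (1 : Matrix (ι × ι) (ι × ι) K) = 1 := by
  ext ⟨i, j, k⟩ ⟨i', j', k'⟩
  simp only [leg12, Matrix.of_apply, Matrix.one_apply, Prod.mk.injEq]
  grind

theorem leg23_one : leg23 (1 : Matrix (ι × ι) (ι × ι) K) = 1 := by
  ext ⟨i, j, k⟩ ⟨i', j', k'⟩
  simp only [leg23, Matrix.of_apply, Matrix.one_apply, Prod.mk.injEq]
  grind

theorem leg12_add (M M' : Matrix (ι × ι) (ι × ι) K) : leg12 (M + M') = leg12 M + leg12 M' := by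
  ext u v
  simp only [leg12, Matrix.of_apply, Matrix.add_apply, ite_add_ite, add_zero]

theorem leg23_add (M M' : Matrix (ι × ι) (ι × ι) K) : leg23 (M + M') = leg23 M + leg23 M' := by
  ext u v
  simp only [leg23, Matrix.of_apply, Matrix.add_apply, ite_add_ite, add_zero]

theorem leg12_smul (c : K) (M : Matrix (ι × ι) (ι × ι) K) : leg12 (c • M) = c • leg12 M := by
  ext u v
  simp only [leg12, Matrix.of_apply, Matrix.smul_apply, smul_ite, smul_zero]

theorem leg23_smul (c : K) (M : Matrix (ι × ι) (ι × ι) K) : leg23 (c • M) = c • leg23 M := by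
  ext u v
  simp only [leg23, Matrix.of_apply, Matrix.smul_apply, smul_ite, smul_zero]

variable [Fintype ι]

theorem leg12_mulVec (M : Matrix (ι × ι) (ι × ι) K) (f : ι × ι × ι → K) (i j k : ι) :
    (leg12 M *ᵥ f) (i, j, k) = (M *ᵥ fun u => f (u.1, u.2, k)) (i, j) := by
  simp [leg12, Matrix.mulVec, dotProduct, Fintype.sum_prod_type]

theorem leg23_mulVec (M : Matrix (ι × ι) (ι × ι) K) (f : ι × ι × ι → K) (i : ι) (u : ι × ι) :
    (leg23 M *ᵥ f) (i, u) = (M *ᵥ fun v => f (i, v)) u := by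
  simp [leg23, Matrix.mulVec, dotProduct, Fintype.sum_prod_type]

theorem leg12_mul (M M' : Matrix (ι × ι) (ι × ι) K) : leg12 (M * M') = leg12 M * leg12 M' := by
  refine Matrix.mulVec_injective (funext fun f => funext fun ⟨i, j, k⟩ => ?_)
  simp only [← Matrix.mulVec_mulVec, leg12_mulVec]

theorem leg23_mul (M M' : Matrix (ι × ι) (ι × ι) K) : leg23 (M * M') = leg23 M * leg23 M' := by
  refine Matrix.mulVec_injective (funext fun f => funext fun ⟨i, u⟩ => ?_)
  simp only [← Matrix.mulVec_mulVec, leg23_mulVec]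

end Legs

section Braid
variable {N : ℕ}

theorem leg12_R_mul_self (N : ℕ) : leg12 (R N) * leg12 (R N) = ξ • leg12 (R N) + 1 := by
  rw [← leg12_mul, R_mul_self, leg12_add, leg12_smul, leg12_one]

theorem leg23_R_mul_self (N : ℕ) : leg23 (R N) * leg23 (R N) = ξ • leg23 (R N) + 1 := by
  rw [← leg23_mul, R_mul_self, leg23_add, leg23_smul, leg23_one]

theorem R_mulVec_of_pos {i j : I N} (hi : 0 < i.1) (hj : 0 < j.1) (f : I N × I N → K) :
    (R N *ᵥ f) (i, j) = (if i = j then q else 1) * f (j, i) +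
      (if i < j then ξ else 0) * f (i, j) := by
  have hlt : ¬ i < opp j := by rw [← Subtype.coe_lt_coe, opp_val]; omega
  have hne : j ≠ opp i := fun h => by rw [h, opp_val] at hj; omega
  have hw : weight i j = if i = j then q else 1 := by
    split_ifs with h
    · rw [← h, weight_self, if_pos hi]
    · rw [weight, φ_of_ne (Ne.symm h) hne, pr_of_pos hi, zero_mul, sg_zero, zpow_zero, mul_one]
  rw [R_mulVec, hw, if_neg hlt, zero_mul, sub_zero]

theorem leg_R_braid_mulVec_of_pos {i j k : I N} (hi : 0 < i.1) (hj : 0 < j.1) (hk : 0 < k.1)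
    (f : I N × I N × I N → K) :
    ((leg12 (R N) * leg23 (R N) * leg12 (R N)) *ᵥ f) (i, j, k) =
      ((leg23 (R N) * leg12 (R N) * leg23 (R N)) *ᵥ f) (i, j, k) := by
  have hq := mul_inv_cancel₀ q_ne_zero
  simp only [← Matrix.mulVec_mulVec, leg12_mulVec, leg23_mulVec, R_mulVec_of_pos, hi, hj, hk, ξ]
  rcases lt_trichotomy i j with h | h | h <;> rcases lt_trichotomy j k with h' | h' | h' <;>
    rcases lt_trichotomy i k with h'' | h'' | h'' <;> grind

/-- Negation of the third index of a triple, with its sign. -/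
def J₃ (N : ℕ) : Matrix (I N × I N × I N) (I N × I N × I N) K :=
  signedPerm (fun u => pr u.1 + pr u.2.1 + pr u.2.2)
    (Equiv.prodCongr 1 (Equiv.prodCongr 1 (oppEquiv N)))

theorem J₃_mul_leg12_R (N : ℕ) : J₃ N * leg12 (R N) = leg12 (R N) * J₃ N := by
  refine Matrix.mulVec_injective (funext fun f => funext fun ⟨i, j, k⟩ => ?_)
  simp only [← Matrix.mulVec_mulVec, J₃, signedPerm_mulVec, leg12_mulVec, R_mulVec,
    Equiv.prodCongr_apply, Prod.map, Equiv.Perm.one_apply, oppEquiv_apply, pr_opp, sg_add, sg_one]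
  ring

theorem J₃_mul_leg23_R (N : ℕ) : J₃ N * leg23 (R N) = leg23 (R N) * leg12 (J₂ N) := by
  refine Matrix.mulVec_injective (funext fun f => funext fun ⟨i, j, k⟩ => ?_)
  simp only [← Matrix.mulVec_mulVec, J₃, J₂, signedPerm_mulVec, leg12_mulVec, leg23_mulVec,
    R_mulVec, Equiv.prodCongr_apply, Prod.map, Equiv.Perm.one_apply, oppEquiv_apply, opp_opp,
    pr_opp, weight_opp_right, sg_add, sg_one]
  have := sg_mul_self (pr j)
  have := sg_mul_self (pr k)
  grind

theorem leg12_J₁_mul_leg23_R (N : ℕ) : leg12 (J₁ N) * leg23 (R N) = leg23 (R N) * leg12 (J₁ N) := by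
  refine Matrix.mulVec_injective (funext fun f => funext fun ⟨i, j, k⟩ => ?_)
  simp only [← Matrix.mulVec_mulVec, J₁, signedPerm_mulVec, leg12_mulVec, leg23_mulVec, R_mulVec,
    Equiv.prodCongr_apply, Prod.map, Equiv.Perm.one_apply, oppEquiv_apply]
  ring

theorem leg12_signedPerm (s : I N × I N → ZMod 2) (σ : Equiv.Perm (I N × I N)) :
    leg12 (signedPerm s σ) = signedPerm (fun u => s (u.1, u.2.1))
      ((Equiv.prodAssoc _ _ _).permCongr (σ.prodCongr 1)) :=
  Matrix.mulVec_injective (funext fun f => funext fun ⟨i, j, k⟩ => by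
    simp [leg12_mulVec, signedPerm_mulVec])

theorem baseChange_self {ι : Type} [Fintype ι] [DecidableEq ι] (P : Matrix ι ι K) :
    baseChange K P = P := by
  ext u v
  simp [baseChange]

theorem R_braid (N : ℕ) : leg12 (R N) * leg23 (R N) * leg12 (R N) =
    leg23 (R N) * leg12 (R N) * leg23 (R N) := by
  let D := leg12 (R N) * leg23 (R N) * leg12 (R N) - leg23 (R N) * leg12 (R N) * leg23 (R N)
  obtain ⟨h₃, h₂, h₁⟩ : J₃ N * D = D * leg12 (J₁ N) ∧ leg12 (J₂ N) * D = D * leg12 (J₂ N) ∧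
      leg12 (J₁ N) * D = D * J₃ N :=
    braid_defect_intertwine (leg12_R_mul_self N) (leg23_R_mul_self N)
      (by rw [← leg12_mul, J₂_mul_R, leg12_mul]) (J₃_mul_leg12_R N) (J₃_mul_leg23_R N)
      (leg12_J₁_mul_leg23_R N)
  rw [← baseChange_self (J₃ N)] at h₃
  rw [← baseChange_self (leg12 (J₂ N)), J₂, leg12_signedPerm] at h₂
  rw [← baseChange_self (leg12 (J₁ N)), J₁, leg12_signedPerm] at h₁
  have hD {i j k : I N} (hi : 0 < i.1) (hj : 0 < j.1) (hk : 0 < k.1) : D (i, j, k) = 0 :=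
    dotProduct_eq_zero _ fun f => by
      change (D *ᵥ f) (i, j, k) = 0
      rw [Matrix.sub_mulVec, Pi.sub_apply, leg_R_braid_mulVec_of_pos hi hj hk f, sub_self]
  have hD' {i j k : I N} (hi : 0 < i.1) (hj : 0 < j.1) : D (i, j, k) = 0 := by
    rcases pos_or_opp_pos k with hk | hk
    · exact hD hi hj hk
    · simpa using row_eq_zero_of_signedPerm_mul h₃ (hD hi hj hk)
  have hD'' {i j k : I N} (hi : 0 < i.1) : D (i, j, k) = 0 := by
    rcases pos_or_opp_pos j with hj | hj
    · exact hD' hi hj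
    · simpa using row_eq_zero_of_signedPerm_mul h₂ (hD' (k := k) hi hj)
  refine sub_eq_zero.1 (funext fun ⟨i, j, k⟩ => ?_)
  rcases pos_or_opp_pos i with hi | hi
  · exact hD'' hi
  · have h : D (i, j, k) = 0 := by
      simpa using row_eq_zero_of_signedPerm_mul h₁ (hD'' (j := j) (k := k) hi)
    exact h

theorem inv_mul_inv_mul_of_braid {A : Type*} [Monoid A] {x y x' y' : A} (h : x * y * x = y * x * y)
    (hx : x' * x = 1) (hx' : x * x' = 1) (hy : y' * y = 1) (hy' : y * y' = 1) :
    x' * y' * x = y * x' * y' := by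
  have h₁ : x' * y' * (y * x) = 1 := by rw [mul_assoc, ← mul_assoc y', hy, one_mul, hx]
  have h₂ : y * x * (x' * y') = 1 := by rw [mul_assoc, ← mul_assoc x, hx', one_mul, hy']
  calc x' * y' * x = x' * y' * (x * y * x) * (x' * y') := by
        rw [mul_assoc x, ← mul_assoc _ x, mul_assoc (_ * x), h₂, mul_one]
    _ = x' * y' * (y * x) * (y * x' * y') := by simp only [h, mul_assoc]
    _ = y * x' * y' := by rw [h₁, one_mul]

theorem leg12_Rinv_leg23_Rinv_leg12_R (N : ℕ) : leg12 (Rinv N) * leg23 (Rinv N) * leg12 (R N) =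
    leg23 (R N) * leg12 (Rinv N) * leg23 (Rinv N) := by
  refine inv_mul_inv_mul_of_braid (R_braid N) ?_ ?_ ?_ ?_ <;>
    simp only [← leg12_mul, ← leg23_mul, Rinv_mul_R, R_mul_Rinv, leg12_one, leg23_one]

theorem leg23_Rinv_leg12_Rinv_leg23_R (N : ℕ) : leg23 (Rinv N) * leg12 (Rinv N) * leg23 (R N) =
    leg12 (R N) * leg23 (Rinv N) * leg12 (Rinv N) := by
  refine inv_mul_inv_mul_of_braid (R_braid N).symm ?_ ?_ ?_ ?_ <;>
    simp only [← leg12_mul, ← leg23_mul, Rinv_mul_R, R_mul_Rinv, leg12_one, leg23_one]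

end Braid

/-! ### Supermatrices as ordinary matrices -/

section Unsign

variable {I₁ I₂ J₁ J₂ L₁ L₂ : Type} [HasParity I₁] [HasParity I₂] [HasParity J₁] [HasParity J₂]
  [HasParity L₁] [HasParity L₂]

/-- The exponent of the sign that turns products of even supermatrices into ordinary products. -/
def twist (u : I₁ × I₂) (v : J₁ × J₂) : ZMod 2 :=
  (pr u.1 + pr v.1) * (pr v.1 + pr v.2) + (pr u.2 + pr v.2) * pr v.2

/-- The ordinary matrix of an even supermatrix. -/
def unsign {B : Type} [AddCommMonoid B] [Module K B] (X : Matrix (I₁ × I₂) (J₁ × J₂) B) :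
    Matrix (I₁ × I₂) (J₁ × J₂) B :=
  Matrix.of fun u v => sg (twist u v) • X u v

theorem unsign_injective {B : Type} [AddCommMonoid B] [Module K B] :
    Function.Injective (unsign : Matrix (I₁ × I₂) (J₁ × J₂) B → _) := fun X Y h => by
  ext u v
  simpa [unsign, smul_smul, sg_mul_self] using
    congrArg (sg (twist u v) • ·) (congrFun (congrFun h u) v)

variable [Fintype J₁] [Fintype J₂]

theorem unsign_superMul {B C D : Type} [AddCommMonoid B] [Module K B] [AddCommMonoid C] [Module K C]
    [AddCommMonoid D] [Module K D] (β : B →ₗ[K] C →ₗ[K] D)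
    (X : Matrix (I₁ × I₂) (J₁ × J₂) B) (Y : Matrix (J₁ × J₂) (L₁ × L₂) C)
    (u : I₁ × I₂) (w : L₁ × L₂) :
    unsign (superMul β X Y) u w = ∑ v, β (unsign X u v) (unsign Y v w) := by
  have hsign : ∀ a b c d e f : ZMod 2,
      (a + e) * (e + f) + (b + f) * f + ((b + d) * (c + e) + (a + c + b + d) * (c + e + d + f)) =
        (c + e) * (e + f) + (d + f) * f + ((a + c) * (c + d) + (b + d) * d) := by decide
  simp only [unsign, Matrix.of_apply, superMul, Finset.smul_sum, map_smul, LinearMap.smul_apply,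
    smul_smul]
  refine Finset.sum_congr rfl fun v _ => ?_
  rw [neg_one_pow_eq_sg, ← sg_add, ← sg_add]
  simp only [Nat.cast_add, Nat.cast_mul, cast_par, twist, hsign]

variable {B : Type} [Semiring B] [Algebra K B]

theorem unsign_mulM (X : Matrix (I₁ × I₂) (J₁ × J₂) B) (Y : Matrix (J₁ × J₂) (L₁ × L₂) B) :
    unsign (mulM X Y) = unsign X * unsign Y := by
  ext u w
  rw [mulM, unsign_superMul, Matrix.mul_apply]
  rfl

theorem unsign_lscal [DecidableEq J₁] [DecidableEq J₂] (X : Matrix (J₁ × J₂) (J₁ × J₂) K)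
    (Y : Matrix (J₁ × J₂) (L₁ × L₂) B) :
    unsign (lscal X Y) = baseChange B (unsign X) * unsign Y := by
  ext u w
  rw [lscal, unsign_superMul, baseChange_mul_apply]
  rfl

theorem unsign_rscal [DecidableEq J₁] [DecidableEq J₂] (X : Matrix (I₁ × I₂) (J₁ × J₂) B)
    (Y : Matrix (J₁ × J₂) (J₁ × J₂) K) :
    unsign (rscal X Y) = unsign X * baseChange B (unsign Y) := by
  ext u w
  rw [rscal, unsign_superMul, mul_baseChange_apply]
  rfl

end Unsign

section Comparison
variable {N : ℕ}

/-- The graded flip, as an ordinary matrix. -/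
def flip (N : ℕ) : Matrix (I N × I N) (I N × I N) K :=
  signedPerm (fun u => pr u.1 * pr u.2) (Equiv.prodComm _ _)

theorem flip_mul_flip (N : ℕ) : flip N * flip N = 1 := by
  refine Matrix.mulVec_injective (funext fun f => funext fun u => ?_)
  simp [flip, ← Matrix.mulVec_mulVec, signedPerm_mulVec, ← mul_assoc, mul_comm (pr u.2),
    sg_mul_self]

theorem sum_diag_apply (c : I N → I N → K) (i j k l : I N) :
    (∑ i' : I N, ∑ j' : I N, c i' j' • E i' i' j' j') (i, j) (k, l) =
      if k = i ∧ l = j then c i j else 0 := by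
  simp only [Matrix.sum_apply, Matrix.smul_apply, E, Matrix.single_apply, Prod.mk.injEq]
  rw [Finset.sum_eq_single i (by simp +contextual) (by simp),
    Finset.sum_eq_single j (by simp +contextual) (by simp)]
  simp [eq_comm]

theorem sum_offdiag_apply (i j k l : I N) :
    (∑ i' : I N, ∑ j' : I N, if i' < j' then
        (-1 : K) ^ par i' • (E j' i' i' j' + E (opp j') (opp i') i' j') else 0) (i, j) (k, l) =
      (if j < i ∧ k = j ∧ l = i then sg (pr j) else 0) +
        (if j < opp i ∧ k = opp j ∧ l = opp i then sg (pr j) else 0) := by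
  have hentry (i' j' : I N) : (if i' < j' then
      (-1 : K) ^ par i' • (E j' i' i' j' + E (opp j') (opp i') i' j') else 0) (i, j) (k, l) =
      (if i' = j then if j' = i then if j < i ∧ k = j ∧ l = i then sg (pr j) else 0 else 0 else 0) +
      (if i' = j then if j' = opp i then if j < opp i ∧ k = opp j ∧ l = opp i then sg (pr j)
        else 0 else 0 else 0) := by
    rw [apply_ite (fun X : Matrix _ _ K => X (i, j) (k, l))]
    simp only [neg_one_pow_eq_sg, cast_par, E, Matrix.smul_apply, Matrix.add_apply,
      Matrix.single_apply, Matrix.zero_apply, Prod.mk.injEq, smul_eq_mul, opp_eq_iff j']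
    grind
  simp only [Matrix.sum_apply, hentry, Finset.sum_add_distrib]
  simp

theorem weight_sub_ite_eq (i j : I N) :
    weight i j - (if i = j then ξ else 0) = sg (pr i * pr j) * q ^ (-φ i j) := by
  rcases eq_or_ne i j with rfl | h
  · rw [weight_self, φ_self]
    have := pr_eq i
    by_cases h : 0 < i.1
    · simp [par, HasParity.par, ξ, h, this]
    · simp only [par, HasParity.par, h, this, ξ, if_true, if_false, mul_one, sg_one, pow_one,
        neg_neg, zpow_one]
      ring
  · rw [if_neg h, sub_zero, weight, φ_swap h]

theorem twist_self (i j : I N) : twist (i, j) (i, j) = 0 := by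
  simp [twist, CharTwo.add_self_eq_zero]

theorem twist_swap (i j : I N) : twist (i, j) (j, i) = pr i * pr j + pr j := by
  have : ∀ a b : ZMod 2, (a + b) * (b + a) + (b + a) * a = a * b + b := by decide
  exact this _ _

theorem twist_opp_swap (i j : I N) :
    twist (i, j) (opp j, opp i) = pr i * pr j + pr i + pr j + 1 := by
  have : ∀ a b : ZMod 2, (a + (b + 1)) * (b + 1 + (a + 1)) + (b + (a + 1)) * (a + 1) =
      a * b + a + b + 1 := by decide
  simpa only [twist, pr_opp] using this _ _

theorem unsign_S (N : ℕ) : unsign (S N) = flip N * R N := by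
  ext ⟨i, j⟩ ⟨k, l⟩
  have hflip : (flip N * R N) (i, j) (k, l) = sg (pr i * pr j) * R N (j, i) (k, l) := by
    rw [← baseChange_self (flip N), flip, signedPerm_mul_apply]
    rfl
  have hdiag := congrArg sg (twist_self i j)
  have hswap := congrArg sg (twist_swap i j)
  have hopp := congrArg sg (twist_opp_swap i j)
  simp only [sg_add, sg_zero, sg_one] at hdiag hswap hopp
  rw [hflip]
  simp only [S, unsign, R, weight, Matrix.of_apply, Matrix.add_apply, Matrix.smul_apply,
    sum_diag_apply, sum_offdiag_apply, Prod.swap_prod_mk, Prod.mk.injEq, smul_eq_mul]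
  have := sg_mul_self (pr i * pr j)
  have := sg_mul_self (pr j)
  have := mul_comm (pr i) (pr j)
  grind

theorem unsign_Sinv_apply (i j k l : I N) :
    unsign (Sinv N) (i, j) (k, l) = sg (pr k * pr l) * Rinv N (i, j) (l, k) := by
  have hdiag := congrArg sg (twist_self i j)
  have hswap := congrArg sg (twist_swap i j)
  have hopp : sg (twist (i, j) (opp j, opp i)) = sg (pr (opp j) * pr (opp i)) := by
    rw [twist_opp_swap, pr_opp, pr_opp]
    ring_nf
  simp only [sg_add, sg_zero] at hdiag hswap
  have hlt : j < opp i ↔ i < opp j := by rw [← opp_lt_opp, opp_opp]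
  simp only [Sinv, unsign, Rinv, R, Matrix.of_apply, Matrix.smul_apply, Matrix.sub_apply,
    Matrix.one_apply, sum_diag_apply, sum_offdiag_apply, Prod.swap_prod_mk, Prod.mk.injEq,
    smul_eq_mul, hlt]
  have := sg_mul_self (pr i * pr j)
  have := sg_mul_self (pr j)
  have := mul_comm (pr i) (pr j)
  have := weight_sub_ite_eq i j
  have := lt_trichotomy i j
  have := @lt_asymm _ _ i j
  grind (splits := 16)

end Comparison

section Ordinary
variable {B : Type} [Semiring B] [Algebra K B] {M N : ℕ}

/-- The ordinary matrix of `X^{1[3]} X^{2[3]}`. -/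
def prod12 (X : Matrix (I M) (I N) B) : Matrix (I M × I M) (I N × I N) B :=
  Matrix.of fun u v =>
    sg ((pr u.1 + pr v.1) * (pr v.1 + pr u.2) + (pr u.2 + pr v.2) * pr v.2) •
      (X u.1 v.1 * X u.2 v.2)

/-- The ordinary matrix of `X^{2[3]} X^{1[3]}`. -/
def prod21 (X : Matrix (I M) (I N) B) : Matrix (I M × I M) (I N × I N) B :=
  Matrix.of fun u v => sg (twist u v) • (X u.2 v.2 * X u.1 v.1)

theorem unsign_leg1_mul_leg2 (X : Matrix (I M) (I N) B) :
    unsign (leg1 (L₁ := I M) X) * unsign (leg2 (L₁ := I N) X) = prod12 X := by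
  have hsign : ∀ i j a c : ZMod 2, (i + a) * (a + j) + (j + j) * j + ((a + a) * (a + c) +
      (j + c) * c) = (i + a) * (a + j) + (j + c) * c := by decide
  ext ⟨i, j⟩ ⟨a, c⟩
  simp only [Matrix.mul_apply, unsign, leg1, leg2, Matrix.of_apply, Fintype.sum_prod_type_right,
    smul_ite, smul_zero, ite_mul, mul_ite, zero_mul, mul_zero, Finset.sum_ite_eq,
    Finset.sum_ite_eq', Finset.mem_univ, if_true, prod12, smul_mul_smul_comm, ← sg_add, twist,
    hsign]

theorem unsign_leg2_mul_leg1 (X : Matrix (I M) (I N) B) :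
    unsign (leg2 (L₁ := I M) X) * unsign (leg1 (L₁ := I N) X) = prod21 X := by
  have hsign : ∀ i j a c : ZMod 2, (i + i) * (i + c) + (j + c) * c + ((i + a) * (a + c) +
      (c + c) * c) = (i + a) * (a + c) + (j + c) * c := by decide
  ext ⟨i, j⟩ ⟨a, c⟩
  simp only [Matrix.mul_apply, unsign, leg1, leg2, Matrix.of_apply, Fintype.sum_prod_type,
    smul_ite, smul_zero, ite_mul, mul_ite, zero_mul, mul_zero, Finset.sum_ite_eq,
    Finset.sum_ite_eq', Finset.mem_univ, if_true, prod21, smul_mul_smul_comm, ← sg_add, twist,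
    hsign]

theorem flip_mul_prod12_mul_flip (X : Matrix (I M) (I N) B) :
    baseChange B (flip M) * prod12 X * baseChange B (flip N) = prod21 X := by
  have hsign : ∀ i j a c : ZMod 2, c * a + (i * j + ((j + c) * (c + i) + (i + a) * a)) =
      (i + a) * (a + c) + (j + c) * c := by decide
  ext ⟨i, j⟩ ⟨a, c⟩
  simp only [flip, mul_signedPerm_apply, signedPerm_mul_apply, prod12, prod21, Matrix.of_apply,
    Equiv.prodComm_symm, Equiv.prodComm_apply, Prod.swap_prod_mk, smul_smul, ← sg_add, twist,
    hsign]

theorem flip_mul_flip_mul {κ : Type} (X : Matrix (I M × I M) κ B) :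
    baseChange B (flip M) * (baseChange B (flip M) * X) = X := by
  rw [← Matrix.mul_assoc, ← map_mul, flip_mul_flip, map_one, Matrix.one_mul]

theorem mul_flip_mul_flip {κ : Type} (X : Matrix κ (I M × I M) B) :
    X * baseChange B (flip M) * baseChange B (flip M) = X := by
  rw [Matrix.mul_assoc, ← map_mul, flip_mul_flip, map_one, Matrix.mul_one]

theorem flip_mul_prod21_mul_flip (X : Matrix (I M) (I N) B) :
    baseChange B (flip M) * prod21 X * baseChange B (flip N) = prod12 X := by
  rw [← flip_mul_prod12_mul_flip, ← Matrix.mul_assoc, mul_flip_mul_flip, flip_mul_flip_mul]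

theorem flip_mul_injective {κ : Type} :
    Function.Injective fun X : Matrix (I M × I M) κ B => baseChange B (flip M) * X :=
  Function.LeftInverse.injective flip_mul_flip_mul

theorem S_mul_leg1_mul_leg2_iff (X : Matrix (I M) (I N) B) :
    mulM (lscal (S M) (leg1 (L₁ := I M) X)) (leg2 (L₁ := I N) X) =
        rscal (mulM (leg2 (L₁ := I M) X) (leg1 (L₁ := I N) X)) (S N) ↔
      baseChange B (R M) * prod12 X = prod12 X * baseChange B (R N) := by
  rw [← unsign_injective.eq_iff, unsign_mulM, unsign_lscal, unsign_rscal, unsign_mulM,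
    unsign_leg2_mul_leg1, Matrix.mul_assoc, unsign_leg1_mul_leg2, ← flip_mul_prod12_mul_flip,
    unsign_S, unsign_S, map_mul, map_mul, ← Matrix.mul_assoc _ (baseChange B (flip N)),
    mul_flip_mul_flip, Matrix.mul_assoc, Matrix.mul_assoc, flip_mul_injective.eq_iff]

theorem leg1_mul_leg2_mul_S_iff (X : Matrix (I M) (I N) B) :
    rscal (mulM (leg1 (L₁ := I M) X) (leg2 (L₁ := I N) X)) (S N) =
        mulM (lscal (S M) (leg2 (L₁ := I M) X)) (leg1 (L₁ := I N) X) ↔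
      baseChange B (R M) * prod21 X = prod21 X * baseChange B (R N) := by
  rw [← unsign_injective.eq_iff, unsign_mulM, unsign_lscal, unsign_rscal, unsign_mulM,
    unsign_leg1_mul_leg2, Matrix.mul_assoc, unsign_leg2_mul_leg1, ← flip_mul_prod21_mul_flip,
    unsign_S, unsign_S, map_mul, map_mul, ← Matrix.mul_assoc _ (baseChange B (flip N)),
    mul_flip_mul_flip, Matrix.mul_assoc, Matrix.mul_assoc, flip_mul_injective.eq_iff, eq_comm]

theorem J₁_mul_prod12 {X : Matrix (I M) (I N) B} (hX : ∀ i a, X (opp i) (opp a) = X i a) :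
    baseChange B (J₁ M) * prod12 X = prod12 X * baseChange B (J₁ N) := by
  have hsymm (a : I N) : (oppEquiv N).symm a = opp a := rfl
  have hone (a : I N) : Equiv.symm (1 : Equiv.Perm (I N)) a = a := rfl
  have hsign : ∀ i j a c : ZMod 2, i + ((i + 1 + a) * (a + j) + (j + c) * c) =
      a + 1 + ((i + (a + 1)) * (a + 1 + j) + (j + c) * c) := by decide
  ext ⟨i, j⟩ ⟨a, c⟩
  have hflip : X (opp i) a = X i (opp a) := by rw [← hX, opp_opp]
  simp [J₁, mul_signedPerm_apply, signedPerm_mul_apply, prod12, smul_smul, ← sg_add, hsymm, hone,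
    hflip, hsign]

theorem J₂_mul_prod12 {X : Matrix (I M) (I N) B} (hX : ∀ i a, X (opp i) (opp a) = X i a) :
    baseChange B (J₂ M) * prod12 X = prod12 X * baseChange B (J₂ N) := by
  have hsymm (a : I N) : (oppEquiv N).symm a = opp a := rfl
  have hone (a : I N) : Equiv.symm (1 : Equiv.Perm (I N)) a = a := rfl
  have hsign : ∀ i j a c : ZMod 2, i + j + ((i + a) * (a + (j + 1)) + (j + 1 + c) * c) =
      a + (c + 1) + ((i + a) * (a + j) + (j + (c + 1)) * (c + 1)) := by decide
  ext ⟨i, j⟩ ⟨a, c⟩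
  have hflip : X (opp j) c = X j (opp c) := by rw [← hX, opp_opp]
  simp [J₂, mul_signedPerm_apply, signedPerm_mul_apply, prod12, smul_smul, ← sg_add, hsymm, hone,
    hflip, hsign]

end Ordinary

/-! ### Universal properties -/

section Map

variable {I₁ I₂ J₁ J₂ L₁ L₂ : Type} {B C : Type} [Semiring B] [Algebra K B] [Semiring C]
  [Algebra K C] (f : B →ₐ[K] C)

theorem map_leg1 [DecidableEq L₁] (X : Matrix I₁ J₁ B) :
    (leg1 (L₁ := L₁) X).map f = leg1 (X.map f) := by
  ext u v
  simp [leg1, apply_ite f]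

theorem map_leg2 [DecidableEq L₁] (X : Matrix I₁ J₁ B) :
    (leg2 (L₁ := L₁) X).map f = leg2 (X.map f) := by
  ext u v
  simp [leg2, apply_ite f]

variable [HasParity I₁] [HasParity I₂] [HasParity J₁] [HasParity J₂] [HasParity L₁]
  [HasParity L₂] [Fintype J₁] [Fintype J₂]

theorem map_mulM (X : Matrix (I₁ × I₂) (J₁ × J₂) B) (Y : Matrix (J₁ × J₂) (L₁ × L₂) B) :
    (mulM X Y).map f = mulM (X.map f) (Y.map f) := by
  ext u v
  simp [mulM, superMul, map_sum, map_smul]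

theorem map_lscal (X : Matrix (I₁ × I₂) (J₁ × J₂) K) (Y : Matrix (J₁ × J₂) (L₁ × L₂) B) :
    (lscal X Y).map f = lscal X (Y.map f) := by
  ext u v
  simp [lscal, superMul, map_sum, map_smul]

theorem map_rscal (X : Matrix (I₁ × I₂) (J₁ × J₂) B) (Y : Matrix (J₁ × J₂) (L₁ × L₂) K) :
    (rscal X Y).map f = rscal (X.map f) Y := by
  ext u v
  simp [rscal, superMul, map_sum, map_smul]

end Map

theorem commute_map_of_adjoin_eq_top {B C : Type} [Semiring B] [Algebra K B] [Semiring C]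
    [Algebra K C] {t : Set C} (ht : Algebra.adjoin K t = ⊤) (f : C →ₐ[K] B) {P : B}
    (h : ∀ x ∈ t, Commute P (f x)) (x : C) : Commute P (f x) := by
  have hle : Algebra.adjoin K t ≤ (Subalgebra.centralizer K {P}).comap f :=
    Algebra.adjoin_le fun x hx => (Subalgebra.mem_centralizer_iff K).2 fun y hy => hy ▸ (h x hx).eq
  exact (Subalgebra.mem_centralizer_iff K).1 (hle (ht ▸ Algebra.mem_top : x ∈ _)) P rfl

section Generators
variable {r s n : ℕ} {B : Type} [Semiring B] [Algebra K B]

theorem freeT_map_lift (X : Matrix (I r) (I n) B) :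
    (freeT r n).map (FreeAlgebra.lift K fun p => X p.1 p.2) = X := by
  ext i a
  simp [freeT]

theorem freeTbar_map_lift (X : Matrix (I n) (I s) B) :
    (freeTbar s n).map
      (FreeAlgebra.lift K fun p => sg (pr p.2 * (pr p.1 + pr p.2)) • X p.2 p.1) = X := by
  ext b α
  simp [freeTbar, neg_one_pow_eq_sg, smul_smul, sg_mul_self]

theorem tbar_eq (α : I s) (b : I n) :
    tbar s n α b = sg (pr b * (pr α + pr b)) • Tbar s n b α := by
  simp [Tbar, neg_one_pow_eq_sg, smul_smul, sg_mul_self]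

theorem T_opp (i : I r) (a : I n) : T r n (opp i) (opp a) = T r n i a :=
  (RingQuot.mkAlgHom_rel K (ARel.opp i a)).symm

theorem Tbar_opp (b : I n) (α : I s) : Tbar s n (opp b) (opp α) = Tbar s n b α := by
  have hsign : ∀ a b : ZMod 2, b * (a + b) + (a + b) = (b + 1) * (a + 1 + (b + 1)) := by decide
  have h : tbar s n α b = sg (pr α + pr b) • tbar s n (opp α) (opp b) := by
    have h := RingQuot.mkAlgHom_rel K (AbarRel.opp α b)
    rw [map_smul, neg_one_pow_eq_sg] at h
    simpa [tbar] using h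
  simp [Tbar, h, neg_one_pow_eq_sg, smul_smul, ← sg_add, hsign]

theorem R_mul_prod12_T : baseChange (A r n) (R r) * prod12 (T r n) =
    prod12 (T r n) * baseChange (A r n) (R n) := by
  have h : (freeT r n).map (RingQuot.mkAlgHom K (ARel r n)) = T r n := rfl
  rw [← S_mul_leg1_mul_leg2_iff, ← h]
  simp only [← map_leg1, ← map_leg2, ← map_lscal, ← map_mulM, ← map_rscal]
  ext u v
  exact RingQuot.mkAlgHom_rel K (ARel.rtt u v)

theorem R_mul_prod21_Tbar : baseChange (Abar s n) (R n) * prod21 (Tbar s n) =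
    prod21 (Tbar s n) * baseChange (Abar s n) (R s) := by
  have h : (freeTbar s n).map (RingQuot.mkAlgHom K (AbarRel s n)) = Tbar s n := by
    ext b α
    simp [freeTbar, Tbar, tbar]
  rw [← leg1_mul_leg2_mul_S_iff, ← h]
  simp only [← map_leg1, ← map_leg2, ← map_lscal, ← map_mulM, ← map_rscal]
  ext u v
  exact RingQuot.mkAlgHom_rel K (AbarRel.rtt u v)

/-- The homomorphism from `A_{r,n}` given by a matrix that satisfies the defining relations. -/
def liftA (X : Matrix (I r) (I n) B) (hX : ∀ i a, X (opp i) (opp a) = X i a)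
    (hR : baseChange B (R r) * prod12 X = prod12 X * baseChange B (R n)) : A r n →ₐ[K] B :=
  RingQuot.liftAlgHom K ⟨FreeAlgebra.lift K fun p => X p.1 p.2, fun x y hxy => by
    cases hxy with
    | opp i a => simp [freeT, hX]
    | rtt u v =>
      have h := (S_mul_leg1_mul_leg2_iff X).2 hR
      rw [← freeT_map_lift X] at h
      simp only [← map_leg1, ← map_leg2, ← map_lscal, ← map_mulM, ← map_rscal] at h
      exact congrFun (congrFun h u) v⟩

theorem liftA_T (X : Matrix (I r) (I n) B) (hX : ∀ i a, X (opp i) (opp a) = X i a)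
    (hR : baseChange B (R r) * prod12 X = prod12 X * baseChange B (R n)) (i : I r) (a : I n) :
    liftA X hX hR (T r n i a) = X i a := by
  rw [liftA, T, RingQuot.liftAlgHom_mkAlgHom_apply, FreeAlgebra.lift_ι_apply]

/-- The homomorphism from `Ā_{s,n}` given by a matrix that satisfies the defining relations. -/
def liftAbar (X : Matrix (I n) (I s) B) (hX : ∀ b α, X (opp b) (opp α) = X b α)
    (hR : baseChange B (R n) * prod21 X = prod21 X * baseChange B (R s)) : Abar s n →ₐ[K] B :=
  RingQuot.liftAlgHom K ⟨FreeAlgebra.lift K fun p => sg (pr p.2 * (pr p.1 + pr p.2)) • X p.2 p.1,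
    fun x y hxy => by
    cases hxy with
    | opp α b =>
      have hsign : ∀ a b : ZMod 2, a + b + (b + 1) * (a + 1 + (b + 1)) = b * (a + b) := by decide
      simp [hX, neg_one_pow_eq_sg, smul_smul, ← sg_add, hsign]
    | rtt u v =>
      have h := (leg1_mul_leg2_mul_S_iff X).2 hR
      rw [← freeTbar_map_lift X] at h
      simp only [← map_leg1, ← map_leg2, ← map_lscal, ← map_mulM, ← map_rscal] at h
      exact congrFun (congrFun h u) v⟩

theorem liftAbar_Tbar (X : Matrix (I n) (I s) B) (hX : ∀ b α, X (opp b) (opp α) = X b α)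
    (hR : baseChange B (R n) * prod21 X = prod21 X * baseChange B (R s)) (b : I n) (α : I s) :
    liftAbar X hX hR (Tbar s n b α) = X b α := by
  rw [Tbar, map_smul, liftAbar, tbar, RingQuot.liftAlgHom_mkAlgHom_apply,
    FreeAlgebra.lift_ι_apply, neg_one_pow_eq_sg]
  simp [smul_smul, sg_mul_self]

variable (r s n)

theorem adjoin_mkAlgHom_ι {X : Type} (rel : FreeAlgebra K X → FreeAlgebra K X → Prop) :
    Algebra.adjoin K (Set.range (RingQuot.mkAlgHom K rel ∘ FreeAlgebra.ι K)) = ⊤ := by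
  rw [Set.range_comp, ← AlgHom.map_adjoin, FreeAlgebra.adjoin_range_ι, Algebra.map_top,
    AlgHom.range_eq_top]
  exact RingQuot.mkAlgHom_surjective K rel

theorem adjoin_T : Algebra.adjoin K {x | ∃ i a, 0 < i.1 ∧ T r n i a = x} = ⊤ := by
  rw [eq_top_iff, ← adjoin_mkAlgHom_ι]
  refine Algebra.adjoin_mono ?_
  rintro _ ⟨⟨i, a⟩, rfl⟩
  rcases pos_or_opp_pos i with hi | hi
  · exact ⟨i, a, hi, rfl⟩
  · exact ⟨opp i, opp a, hi, T_opp i a⟩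

theorem adjoin_Tbar : Algebra.adjoin K {x | ∃ b α, Tbar s n b α = x} = ⊤ := by
  rw [eq_top_iff, ← adjoin_mkAlgHom_ι]
  refine Algebra.adjoin_le ?_
  rintro _ ⟨⟨α, b⟩, rfl⟩
  change tbar s n α b ∈ _
  rw [tbar_eq]
  have h : Tbar s n b α ∈ {x | ∃ b α, Tbar s n b α = x} := ⟨b, α, rfl⟩
  exact Subalgebra.smul_mem _ (Algebra.subset_adjoin h) _

variable {r n}

theorem algHom_ext_of_pos {f g : A r n →ₐ[K] B}
    (h : ∀ i a, 0 < i.1 → f (T r n i a) = g (T r n i a)) : f = g := by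
  refine AlgHom.ext_of_adjoin_eq_top (adjoin_T r n) ?_
  rintro _ ⟨i, a, hi, rfl⟩
  exact h i a hi

theorem commute_map_of_pos (f : A r n →ₐ[K] B) {P : B}
    (h : ∀ i a, 0 < i.1 → Commute P (f (T r n i a))) (x : A r n) : Commute P (f x) := by
  refine commute_map_of_adjoin_eq_top (adjoin_T r n) f ?_ x
  rintro _ ⟨i, a, hi, rfl⟩
  exact h i a hi

end Generators

/-! ### The exchange homomorphisms -/

section RowParity
variable {N : ℕ}

theorem R_apply_eq_zero {u v : I N × I N} (h : pr u.1 + pr u.2 ≠ pr v.1 + pr v.2) :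
    R N u v = 0 := by
  have hsign : ∀ a b : ZMod 2, a + 1 + (b + 1) = a + b := by decide
  have h₁ : v ≠ u.swap := by rintro rfl; exact h (add_comm _ _)
  have h₂ : v ≠ u := by rintro rfl; exact h rfl
  have h₃ : v ≠ (opp u.1, opp u.2) := by rintro rfl; simp [hsign] at h
  simp [R, h₁, h₂, h₃]

theorem Rinv_apply_eq_zero {u v : I N × I N} (h : pr u.1 + pr u.2 ≠ pr v.1 + pr v.2) :
    Rinv N u v = 0 := by
  have h' : u ≠ v := by rintro rfl; exact h rfl
  simp [Rinv, R_apply_eq_zero h, h']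

theorem Rinv_opp_opp (b x a d : I N) :
    Rinv N (opp b, x) (a, opp d) = sg (pr x) * Rinv N (b, x) (a, d) := by
  by_cases h : pr b + pr x = pr a + pr d
  · have hJ := congrFun (congrFun (J₁_mul_Rinv N) (b, x)) (a, opp d)
    rw [← baseChange_self (J₁ N), ← baseChange_self (J₂ N), J₁, J₂, signedPerm_mul_apply,
      mul_signedPerm_apply] at hJ
    have hx : pr x = pr b + (pr a + pr d) := by grind
    have hd : (Equiv.prodCongr 1 (oppEquiv N)).symm (a, opp d) = (a, d) :=
      Prod.ext rfl (opp_opp d)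
    have hb : (oppEquiv N).prodCongr 1 (b, x) = (opp b, x) := rfl
    rw [hd, hb, smul_eq_mul, smul_eq_mul] at hJ
    rw [hx, sg_add, mul_assoc, ← hJ, ← mul_assoc, sg_mul_self, one_mul]
  · have h' : pr (opp b) + pr x ≠ pr a + pr (opp d) := by
      simpa [add_right_comm _ (1 : ZMod 2), ← add_assoc] using h
    rw [Rinv_apply_eq_zero (u := (b, x)) (v := (a, d)) h,
      Rinv_apply_eq_zero (u := (opp b, x)) (v := (a, opp d)) h', mul_zero]

theorem commute_R_diagonal (ε : ZMod 2) :
    Commute (R N) (Matrix.diagonal fun u => sg (ε * (pr u.1 + pr u.2))) := by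
  ext u v
  rw [Matrix.mul_diagonal, Matrix.diagonal_mul]
  by_cases h : pr u.1 + pr u.2 = pr v.1 + pr v.2
  · rw [h, mul_comm]
  · rw [R_apply_eq_zero h, mul_zero, zero_mul]

theorem R_apply_eq_zero_of_pos {i j : I N} (hi : 0 < i.1) (hj : 0 < j.1) {v : I N × I N}
    (hv : ¬ (0 < v.1.1 ∧ 0 < v.2.1)) : R N (i, j) v = 0 := by
  have h₁ : v ≠ (j, i) := by rintro rfl; exact hv ⟨hj, hi⟩
  have h₂ : v ≠ (i, j) := by rintro rfl; exact hv ⟨hi, hj⟩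
  have h₃ : ¬ i < opp j := by rw [← Subtype.coe_lt_coe, opp_val]; omega
  simp [R, h₁, h₂, h₃]

theorem R_mul_congr_of_pos {κ B : Type} [Semiring B] [Algebra K B] {W W' : Matrix (I N × I N) κ B}
    (h : ∀ i j : I N, 0 < i.1 → 0 < j.1 → W (i, j) = W' (i, j)) {i j : I N} (hi : 0 < i.1)
    (hj : 0 < j.1) : (baseChange B (R N) * W) (i, j) = (baseChange B (R N) * W') (i, j) := by
  ext v
  rw [baseChange_mul_apply, baseChange_mul_apply]
  refine Finset.sum_congr rfl fun x _ => ?_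
  by_cases hx : 0 < x.1.1 ∧ 0 < x.2.1
  · rw [h x.1 x.2 hx.1 hx.2]
  · rw [R_apply_eq_zero_of_pos hi hj hx, zero_smul, zero_smul]

end RowParity

section Slice
variable {ι : Type}

/-- The matrix in the last two row and the first two column indices of a matrix on a triple tensor
product, the other two indices being fixed. -/
def sliceLR (b d : ι) (G : Matrix (ι × ι × ι) (ι × ι × ι) K) : Matrix (ι × ι) (ι × ι) K :=
  G.submatrix (fun x => (b, x)) fun v => (v.1, v.2, d)

/-- The matrix in the first two row and the last two column indices of a matrix on a triple tensor
product, the other two indices being fixed. -/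
def sliceRL (x a : ι) (G : Matrix (ι × ι × ι) (ι × ι × ι) K) : Matrix (ι × ι) (ι × ι) K :=
  G.submatrix (fun u => (u.1, u.2, x)) fun w => (a, w)

variable [Fintype ι] [DecidableEq ι] (P Q : Matrix (ι × ι) (ι × ι) K)
  (G : Matrix (ι × ι × ι) (ι × ι × ι) K)

theorem sliceLR_leg23_mul (b d : ι) : sliceLR b d (leg23 P * G) = P * sliceLR b d G := by
  ext u v
  simp [sliceLR, leg23, Matrix.mul_apply, Fintype.sum_prod_type, ite_mul]

theorem sliceLR_mul_leg12 (b d : ι) : sliceLR b d (G * leg12 P) = sliceLR b d G * P := by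
  ext u v
  simp [sliceLR, leg12, Matrix.mul_apply, Fintype.sum_prod_type, mul_ite]

theorem sliceRL_leg12_mul (x a : ι) : sliceRL x a (leg12 P * G) = P * sliceRL x a G := by
  ext u v
  simp [sliceRL, leg12, Matrix.mul_apply, Fintype.sum_prod_type, ite_mul]

theorem sliceRL_mul_leg23 (x a : ι) : sliceRL x a (G * leg23 P) = sliceRL x a G * P := by
  ext u v
  simp [sliceRL, leg23, Matrix.mul_apply, Fintype.sum_prod_type, mul_ite]

theorem sliceLR_leg12_mul_leg23_apply (b d : ι) (x v : ι × ι) :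
    sliceLR b d (leg12 P * leg23 Q) x v = ∑ z, P (b, x.1) (v.1, z) * Q (z, x.2) (v.2, d) := by
  simp [sliceLR, leg12, leg23, Matrix.mul_apply, Fintype.sum_prod_type, ite_mul, mul_ite]

theorem sliceRL_leg23_mul_leg12_apply (x a : ι) (u w : ι × ι) :
    sliceRL x a (leg23 P * leg12 Q) u w = ∑ y, Q (u.1, y) (a, w.1) * P (u.2, x) (y, w.2) := by
  simp [sliceRL, leg12, leg23, Matrix.mul_apply, Fintype.sum_prod_type, ite_mul, mul_ite,
    mul_comm]

theorem commute_R_sliceLR {N : ℕ} (b d : I N) :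
    Commute (R N) (sliceLR b d (leg12 (Rinv N) * leg23 (Rinv N))) := by
  rw [commute_iff_eq, ← sliceLR_leg23_mul, ← sliceLR_mul_leg12, leg12_Rinv_leg23_Rinv_leg12_R,
    Matrix.mul_assoc]

theorem commute_R_sliceRL {N : ℕ} (x a : I N) :
    Commute (R N) (sliceRL x a (leg23 (Rinv N) * leg12 (Rinv N))) := by
  rw [commute_iff_eq, ← sliceRL_leg12_mul, ← sliceRL_mul_leg23, leg23_Rinv_leg12_Rinv_leg23_R,
    Matrix.mul_assoc]

end Slice

section Exchange
variable {r n : ℕ}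

/-- The coefficients, for a positive index `i`, of the exchange relation between `t_{ia}` and a
column of parity `ε` of `T̄`. -/
def exchangePos (ε : ZMod 2) (i : I r) (a : I n) : Matrix (I n) (I n) (A r n) :=
  Matrix.of fun b d => ∑ x, (sg ((ε + 1) * pr x + pr a) * Rinv n (b, x) (a, d)) • T r n i x

/-- The coefficients of the exchange relation between `T` and a column of parity `ε` of `T̄`. -/
def exchange (ε : ZMod 2) : Matrix (I r) (I n) (Matrix (I n) (I n) (A r n)) :=
  Matrix.of fun i a => if 0 < i.1 then exchangePos ε i a else exchangePos ε (opp i) (opp a)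

theorem exchange_opp (ε : ZMod 2) (i : I r) (a : I n) :
    exchange ε (opp i) (opp a) = exchange ε i a := by
  have := val_ne_zero i
  simp only [exchange, Matrix.of_apply, opp_val, opp_opp]
  split_ifs <;> first | rfl | omega

theorem sum_mul_sum_smul {ι κ B : Type} [Fintype ι] [Fintype κ] [Semiring B] [Algebra K B]
    (f : ι → κ → K) (g : κ → ι → K) (t t' : ι → B) :
    ∑ z, (∑ x, f x z • t x) * (∑ y, g z y • t' y) =
      ∑ x : ι × ι, (∑ z, f x.1 z * g z x.2) • (t x.1 * t' x.2) := by
  simp only [Finset.sum_mul_sum, smul_mul_smul_comm, Finset.sum_smul, Fintype.sum_prod_type]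
  rw [Finset.sum_comm]
  exact Finset.sum_congr rfl fun x _ => Finset.sum_comm

theorem exchangePos_mul_apply (ε : ZMod 2) (i j : I r) (a c b d : I n) :
    (exchangePos ε i a * exchangePos ε j c) b d =
      ∑ x : I n × I n, (sg ((ε + 1) * (pr x.1 + pr x.2) + pr a + pr c) *
        sliceLR b d (leg12 (Rinv n) * leg23 (Rinv n)) x (a, c)) • (T r n i x.1 * T r n j x.2) := by
  rw [Matrix.mul_apply]
  simp only [exchangePos, Matrix.of_apply]
  refine (sum_mul_sum_smul (fun x z => sg ((ε + 1) * pr x + pr a) * Rinv n (b, x) (a, z))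
    (fun z y => sg ((ε + 1) * pr y + pr c) * Rinv n (z, y) (c, d)) _ _).trans ?_
  refine Finset.sum_congr rfl fun x _ => congrArg (· • _) ?_
  rw [sliceLR_leg12_mul_leg23_apply, Finset.mul_sum]
  refine Finset.sum_congr rfl fun z _ => ?_
  simp only [sg_add, mul_add]
  ring

theorem prod12_exchange_of_pos (ε : ZMod 2) {i j : I r} (hi : 0 < i.1) (hj : 0 < j.1)
    (b d : I n) :
    (prod12 (exchange ε)).map (fun M => M b d) (i, j) =
      (prod12 (T r n) * baseChange (A r n)
        (Matrix.diagonal (fun x : I n × I n => sg (ε * (pr x.1 + pr x.2))) *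
          sliceLR b d (leg12 (Rinv n) * leg23 (Rinv n)))) (i, j) := by
  ext ⟨a, c⟩
  have hsign : ∀ a c x y : ZMod 2, (0 + a) * (a + 0) + (0 + c) * c +
      ((ε + 1) * (x + y) + a + c) = ε * (x + y) + ((0 + x) * (x + 0) + (0 + y) * y) := by
    revert ε
    decide
  rw [mul_baseChange_apply]
  simp only [Matrix.map_apply, prod12, exchange, Matrix.of_apply, hi, hj, if_true,
    Matrix.smul_apply, exchangePos_mul_apply, Matrix.diagonal_mul, pr_of_pos hi, pr_of_pos hj,
    Finset.smul_sum, smul_smul]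
  refine Finset.sum_congr rfl fun x _ => congrArg (· • _) ?_
  rw [← mul_assoc, ← sg_add, hsign, sg_add]
  ring

theorem R_mul_prod12_exchange (ε : ZMod 2) :
    baseChange (Matrix (I n) (I n) (A r n)) (R r) * prod12 (exchange (r := r) (n := n) ε) =
      prod12 (exchange (r := r) (n := n) ε) * baseChange (Matrix (I n) (I n) (A r n)) (R n) := by
  refine R_mul_eq_mul_R_of_pos (J₁_mul_prod12 (exchange_opp ε)) (J₂_mul_prod12 (exchange_opp ε))
    fun i j hi hj => ?_
  ext v b d
  let Q := Matrix.diagonal (fun x : I n × I n => sg (ε * (pr x.1 + pr x.2))) *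
    sliceLR b d (leg12 (Rinv n) * leg23 (Rinv n))
  have hQ : Commute (R n) Q := (commute_R_diagonal ε).mul_right (commute_R_sliceLR b d)
  let W : Matrix (I r × I r) (I n × I n) (A r n) := (prod12 (exchange ε)).map fun M => M b d
  have hW {i j : I r} (hi : 0 < i.1) (hj : 0 < j.1) :
      W (i, j) = (prod12 (T r n) * baseChange (A r n) Q) (i, j) :=
    prod12_exchange_of_pos ε hi hj b d
  calc _ = (baseChange (A r n) (R r) * W) (i, j) v := by
        simp [W, baseChange_mul_apply, Matrix.sum_apply]
    _ = (baseChange (A r n) (R r) * (prod12 (T r n) * baseChange (A r n) Q)) (i, j) v :=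
        congrFun (R_mul_congr_of_pos (fun _ _ => hW) hi hj) v
    _ = (prod12 (T r n) * baseChange (A r n) Q * baseChange (A r n) (R n)) (i, j) v := by
        rw [← Matrix.mul_assoc, R_mul_prod12_T, Matrix.mul_assoc, Matrix.mul_assoc, ← map_mul,
          ← map_mul, hQ.eq]
    _ = (W * baseChange (A r n) (R n)) (i, j) v := by
        simp only [Matrix.mul_apply, hW hi hj]
    _ = _ := by
        simp [W, mul_baseChange_apply, Matrix.sum_apply]

/-- The homomorphism that describes moving a column of parity `ε` of `T̄` past an element of
`A_{r,n}`; its matrix indices are the row indices of `T̄` before and after. -/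
def exchangeHom (ε : ZMod 2) : A r n →ₐ[K] Matrix (I n) (I n) (A r n) :=
  liftA (exchange ε) (exchange_opp ε) (R_mul_prod12_exchange ε)

theorem exchangeHom_T_of_pos (ε : ZMod 2) {i : I r} (hi : 0 < i.1) (a b d : I n) :
    exchangeHom ε (T r n i a) b d =
      ∑ x, (sg ((ε + 1) * pr x + pr a) * Rinv n (b, x) (a, d)) • T r n i x := by
  rw [exchangeHom, liftA_T, exchange, Matrix.of_apply, if_pos hi, exchangePos, Matrix.of_apply]

theorem exchangeHom_opp (ε : ZMod 2) (f : A r n) (b d : I n) :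
    exchangeHom (ε + 1) f (opp b) (opp d) = exchangeHom ε f b d := by
  have hsign : ∀ x a : ZMod 2, (ε + 1 + 1) * x + a + x = (ε + 1) * x + a := by
    revert ε
    decide
  have h : (Matrix.reindexAlgEquiv K (A r n) (oppEquiv n)).toAlgHom.comp (exchangeHom (ε + 1)) =
      exchangeHom ε := by
    refine algHom_ext_of_pos fun i a hi => ?_
    ext b d
    change exchangeHom (ε + 1) (T r n i a) (opp b) (opp d) = _
    simp only [exchangeHom_T_of_pos _ hi, Rinv_opp_opp, ← mul_assoc, ← sg_add, hsign]
  exact congrFun (congrFun (DFunLike.congr_fun h f) b) d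

end Exchange

section Twofold

/-- Conjugation by the diagonal matrix of signs `(-1)^{s u}`. -/
def signConj {ι B : Type} [Fintype ι] [DecidableEq ι] [Semiring B] [Algebra K B] (s : ι → ZMod 2) :
    Matrix ι ι B →ₐ[K] Matrix ι ι B where
  toFun M := Matrix.of fun u w => sg (s u + s w) • M u w
  map_zero' := by ext; simp
  map_one' := by
    ext u w
    obtain rfl | h := eq_or_ne u w <;> simp [CharTwo.add_self_eq_zero, *]
  map_add' M M' := by ext; simp
  map_mul' M M' := by
    have hsign : ∀ u v w : ZMod 2, v + w + (u + v) = u + w := by decide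
    ext
    simp [Matrix.mul_apply, Finset.smul_sum, smul_smul, ← sg_add, hsign]
  commutes' c := by
    ext u w
    obtain rfl | h := eq_or_ne u w <;>
      simp [CharTwo.add_self_eq_zero, Matrix.algebraMap_matrix_apply, *]

section Scalar
variable {ι B : Type} [Fintype ι] [DecidableEq ι] [Semiring B] [Algebra K B]

theorem baseChange_mul_scalar_apply (Q : Matrix ι ι K) (t : B) (u w : ι) :
    (baseChange B Q * Matrix.scalar ι t) u w = Q u w • t := by
  simp [baseChange, Algebra.ofId_apply, Algebra.smul_def]

theorem commute_baseChange_scalar (P : Matrix ι ι K) (t : B) :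
    Commute (baseChange B P) (Matrix.scalar ι t) := by
  ext u w
  simp [baseChange, Algebra.ofId_apply, Algebra.commutes]

end Scalar

variable {r n : ℕ}

/-- The homomorphism that describes moving two columns of `T̄`, of parities `ε` and `δ`, past an
element of `A_{r,n}`, with the signs that make it depend on `ε + δ` only. -/
def twofold (ε δ : ZMod 2) : A r n →ₐ[K] Matrix (I n × I n) (I n × I n) (A r n) :=
  (signConj fun u => pr u.1 * (ε + δ) + pr u.2 * δ).comp <|
    (Matrix.compAlgEquiv (I n) (I n) (A r n) K).toAlgHom.comp <|
      (exchangeHom δ).mapMatrix.comp (exchangeHom ε)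

theorem twofold_apply (ε δ : ZMod 2) (f : A r n) (u w : I n × I n) :
    twofold ε δ f u w = sg (pr u.1 * (ε + δ) + pr u.2 * δ + (pr w.1 * (ε + δ) + pr w.2 * δ)) •
      exchangeHom δ (exchangeHom ε f u.1 w.1) u.2 w.2 := rfl

theorem twofold_T_of_pos (ε δ : ZMod 2) {i : I r} (hi : 0 < i.1) (a : I n) :
    twofold ε δ (T r n i a) = ∑ x, sg ((ε + δ + 1) * pr a + pr x) •
      (baseChange _ (sliceRL x a (leg23 (Rinv n) * leg12 (Rinv n))) *
        Matrix.scalar _ (T r n i x)) := by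
  ext u w
  simp only [twofold_apply, exchangeHom_T_of_pos _ hi, map_sum, map_smul, Matrix.sum_apply,
    Matrix.smul_apply, baseChange_mul_scalar_apply, sliceRL_leg23_mul_leg12_apply, Finset.smul_sum,
    Finset.sum_smul, smul_smul]
  rw [Finset.sum_comm]
  refine Finset.sum_congr rfl fun x _ => Finset.sum_congr rfl fun y _ => congrArg (· • _) ?_
  by_cases h₁ : pr u.1 + pr y = pr a + pr w.1
  swap
  · rw [Rinv_apply_eq_zero (u := (u.1, y)) (v := (a, w.1)) h₁]
    ring
  by_cases h₂ : pr u.2 + pr x = pr y + pr w.2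
  swap
  · rw [Rinv_apply_eq_zero (u := (u.2, x)) (v := (y, w.2)) h₂]
    ring
  have hsign : ∀ u₁ u₂ w₁ w₂ x y a : ZMod 2, u₁ + y = a + w₁ → u₂ + x = y + w₂ →
      u₁ * (ε + δ) + u₂ * δ + (w₁ * (ε + δ) + w₂ * δ) + ((ε + 1) * y + a) + ((δ + 1) * x + y) =
        (ε + δ + 1) * a + x := by
    revert ε δ
    decide
  have h := congrArg sg (hsign _ _ _ _ _ _ _ h₁ h₂)
  rw [sg_add _ ((δ + 1) * pr x + pr y), sg_add _ ((ε + 1) * pr y + pr a)] at h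
  linear_combination Rinv n (u.1, y) (a, w.1) * Rinv n (u.2, x) (y, w.2) * h

theorem twofold_congr {ε δ ε' δ' : ZMod 2} (h : ε + δ = ε' + δ') :
    (twofold ε δ : A r n →ₐ[K] _) = twofold ε' δ' :=
  algHom_ext_of_pos fun i a hi => by rw [twofold_T_of_pos _ _ hi, twofold_T_of_pos _ _ hi, h]

theorem commute_R_twofold (ε δ : ZMod 2) (f : A r n) :
    Commute (baseChange _ (R n)) (twofold ε δ f) := by
  refine commute_map_of_pos _ (fun i a hi => ?_) f
  rw [twofold_T_of_pos _ _ hi]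
  exact Commute.sum_right _ _ _ fun x _ => (((commute_R_sliceRL x a).map (baseChange _)).mul_right
    (commute_baseChange_scalar _ _)).smul_right _

end Twofold

/-! ### Twisted multiplication -/

section Braided
variable {B C : Type} [Semiring B] [Algebra K B] [Semiring C] [Algebra K C]

theorem rTensor_mul'_assoc_symm (b : B) (z : B ⊗[K] C) :
    (LinearMap.mul' K B).rTensor C ((TensorProduct.assoc K B B C).symm (b ⊗ₜ z)) =
      (b ⊗ₜ 1) * z := by
  induction z with
  | zero => simp
  | add z w hz hw => simp only [TensorProduct.tmul_add, map_add, hz, hw, mul_add]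
  | tmul x y => simp

theorem lTensor_mul'_assoc (z : B ⊗[K] C) (c : C) :
    (LinearMap.mul' K C).lTensor B (TensorProduct.assoc K B C C (z ⊗ₜ c)) = z * (1 ⊗ₜ c) := by
  induction z with
  | zero => simp
  | add z w hz hw => simp only [TensorProduct.add_tmul, map_add, hz, hw, add_mul]
  | tmul x y => simp

theorem map_mul'_assoc_symm (b : B) (z : B ⊗[K] C) (c : C) :
    TensorProduct.map (LinearMap.mul' K B) (LinearMap.mul' K C)
      ((TensorProduct.assoc K B B (C ⊗[K] C)).symm (b ⊗ₜ TensorProduct.assoc K B C C (z ⊗ₜ c))) =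
      (b ⊗ₜ 1) * z * (1 ⊗ₜ c) := by
  induction z with
  | zero => simp
  | add z w hz hw =>
    simp only [TensorProduct.add_tmul, TensorProduct.tmul_add, map_add, hz, hw, mul_add, add_mul]
  | tmul x y => simp

variable (Υ : C ⊗[K] B →ₗ[K] B ⊗[K] C)

theorem braidedMul_tmul (b b' : B) (c c' : C) :
    braidedMul Υ ((b ⊗ₜ c) ⊗ₜ (b' ⊗ₜ c')) = (b ⊗ₜ 1) * Υ (c ⊗ₜ b') * (1 ⊗ₜ c') :=
  map_mul'_assoc_symm _ _ _

theorem braidedMul_mul_left (b : B) (z w : B ⊗[K] C) :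
    braidedMul Υ (((b ⊗ₜ 1) * z) ⊗ₜ w) = (b ⊗ₜ 1) * braidedMul Υ (z ⊗ₜ w) := by
  induction z with
  | zero => simp
  | add z z' hz hz' => simp only [mul_add, TensorProduct.add_tmul, map_add, hz, hz']
  | tmul x y =>
    induction w with
    | zero => simp
    | add w w' hw hw' => simp only [mul_add, TensorProduct.tmul_add, map_add, hw, hw']
    | tmul x' y' => simp [braidedMul_tmul, ← mul_assoc]

theorem braidedMul_mul_right (z w : B ⊗[K] C) (c : C) :
    braidedMul Υ (z ⊗ₜ (w * (1 ⊗ₜ c))) = braidedMul Υ (z ⊗ₜ w) * (1 ⊗ₜ c) := by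
  induction z with
  | zero => simp
  | add z z' hz hz' => simp only [add_mul, TensorProduct.add_tmul, map_add, hz, hz']
  | tmul x y =>
    induction w with
    | zero => simp
    | add w w' hw hw' => simp only [add_mul, TensorProduct.tmul_add, map_add, hw, hw']
    | tmul x' y' => simp [braidedMul_tmul, mul_assoc]

theorem braidedMul_tmul_one (z : B ⊗[K] C) (f : B) :
    braidedMul Υ (z ⊗ₜ (f ⊗ₜ 1)) = (LinearMap.mul' K B).rTensor C
      ((TensorProduct.assoc K B B C).symm
        (Υ.lTensor B (TensorProduct.assoc K B C B (z ⊗ₜ f)))) := by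
  induction z with
  | zero => simp
  | add z w hz hw => simp only [TensorProduct.add_tmul, map_add, hz, hw]
  | tmul x y =>
    simp [braidedMul_tmul, rTensor_mul'_assoc_symm, ← Algebra.TensorProduct.one_def]

theorem braidedMul_one_tmul (c : C) (z : B ⊗[K] C) :
    braidedMul Υ ((1 ⊗ₜ c) ⊗ₜ z) = (LinearMap.mul' K C).lTensor B
      (TensorProduct.assoc K B C C
        (Υ.rTensor C ((TensorProduct.assoc K C B C).symm (c ⊗ₜ z)))) := by
  induction z with
  | zero => simp
  | add z w hz hw => simp only [TensorProduct.tmul_add, map_add, hz, hw]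
  | tmul x y => simp [braidedMul_tmul, lTensor_mul'_assoc, ← Algebra.TensorProduct.one_def]

theorem diagram1_iff : Diagram1 Υ ↔ ∀ (c : C) (f f' : B),
    Υ (c ⊗ₜ (f * f')) = braidedMul Υ (Υ (c ⊗ₜ f) ⊗ₜ (f' ⊗ₜ 1)) := by
  simp only [braidedMul_tmul_one]
  exact ⟨fun h c f f' => LinearMap.congr_fun h (c ⊗ₜ (f ⊗ₜ f')),
    fun h => TensorProduct.ext <| LinearMap.ext fun c => TensorProduct.ext' (h c)⟩

theorem diagram2_iff : Diagram2 Υ ↔ ∀ (c c' : C) (f : B),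
    Υ ((c * c') ⊗ₜ f) = braidedMul Υ ((1 ⊗ₜ c) ⊗ₜ Υ (c' ⊗ₜ f)) := by
  simp only [braidedMul_one_tmul]
  exact ⟨fun h c c' f => LinearMap.congr_fun h ((c ⊗ₜ c') ⊗ₜ f),
    fun h => TensorProduct.ext_threefold h⟩

variable {Υ}

theorem Diagram2.braidedMul_mul_tmul (h : Diagram2 Υ) (z : B ⊗[K] C) (c c' : C) (b : B) :
    braidedMul Υ ((z * (1 ⊗ₜ c)) ⊗ₜ (b ⊗ₜ c')) =
      braidedMul Υ (z ⊗ₜ Υ (c ⊗ₜ b)) * (1 ⊗ₜ c') := by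
  induction z with
  | zero => simp
  | add z w hz hw => simp only [add_mul, TensorProduct.add_tmul, map_add, hz, hw]
  | tmul x y =>
    rw [Algebra.TensorProduct.tmul_mul_tmul, mul_one, braidedMul_tmul, (diagram2_iff Υ).1 h,
      ← braidedMul_mul_left, Algebra.TensorProduct.tmul_mul_tmul, mul_one, one_mul]

theorem Diagram1.braidedMul_tmul_mul (h : Diagram1 Υ) (b b' : B) (c : C) (z : B ⊗[K] C) :
    braidedMul Υ ((b ⊗ₜ c) ⊗ₜ ((b' ⊗ₜ 1) * z)) =
      (b ⊗ₜ 1) * braidedMul Υ (Υ (c ⊗ₜ b') ⊗ₜ z) := by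
  induction z with
  | zero => simp
  | add z w hz hw => simp only [mul_add, TensorProduct.tmul_add, map_add, hz, hw]
  | tmul x y =>
    rw [Algebra.TensorProduct.tmul_mul_tmul, one_mul, braidedMul_tmul, (diagram1_iff Υ).1 h,
      mul_assoc, ← braidedMul_mul_right, Algebra.TensorProduct.tmul_mul_tmul, mul_one, one_mul]

theorem braidedMul_assoc (h₁ : Diagram1 Υ) (h₂ : Diagram2 Υ) (x y z : B ⊗[K] C) :
    braidedMul Υ (braidedMul Υ (x ⊗ₜ y) ⊗ₜ z) = braidedMul Υ (x ⊗ₜ braidedMul Υ (y ⊗ₜ z)) := by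
  induction x with
  | zero => simp
  | add x x' hx hx' => simp only [TensorProduct.add_tmul, map_add, hx, hx']
  | tmul b c =>
    induction y with
    | zero => simp
    | add y y' hy hy' =>
      simp only [TensorProduct.add_tmul, TensorProduct.tmul_add, map_add, hy, hy']
    | tmul b' c' =>
      induction z with
      | zero => simp
      | add z z' hz hz' => simp only [TensorProduct.tmul_add, map_add, hz, hz']
      | tmul b'' c'' =>
        rw [braidedMul_tmul, mul_assoc, braidedMul_mul_left, h₂.braidedMul_mul_tmul,
          braidedMul_tmul, mul_assoc, h₁.braidedMul_tmul_mul, braidedMul_mul_right]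

theorem one_braidedMul (h : ∀ f : B, Υ (1 ⊗ₜ f) = f ⊗ₜ 1) (x : B ⊗[K] C) :
    braidedMul Υ ((1 ⊗ₜ 1) ⊗ₜ x) = x := by
  induction x with
  | zero => simp
  | add x x' hx hx' => simp only [TensorProduct.tmul_add, map_add, hx, hx']
  | tmul b c => simp [braidedMul_tmul, h]

theorem braidedMul_one (h : ∀ g : C, Υ (g ⊗ₜ 1) = 1 ⊗ₜ g) (x : B ⊗[K] C) :
    braidedMul Υ (x ⊗ₜ (1 ⊗ₜ 1)) = x := by
  induction x with
  | zero => simp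
  | add x x' hx hx' => simp only [TensorProduct.add_tmul, map_add, hx, hx']
  | tmul b c => simp [braidedMul_tmul, h]

end Braided

section Twisting
variable {B C : Type} [Semiring B] [Algebra K B] [Semiring C] [Algebra K C]

/-- The twisting map `c ⊗ f ↦ ρ(c)(f ⊗ 1)` of an action `ρ` of `C` on `B ⊗ C`. -/
def twisting (ρ : C →ₐ[K] Module.End K (B ⊗[K] C)) : C ⊗[K] B →ₗ[K] B ⊗[K] C :=
  TensorProduct.lift
    (LinearMap.lcomp K (B ⊗[K] C) ((TensorProduct.mk K B C).flip 1) ∘ₗ ρ.toLinearMap)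

variable {ρ : C →ₐ[K] Module.End K (B ⊗[K] C)}

@[simp] theorem twisting_tmul (c : C) (f : B) : twisting ρ (c ⊗ₜ f) = ρ c (f ⊗ₜ 1) := rfl

theorem twisting_one_tmul (f : B) : twisting ρ (1 ⊗ₜ f) = f ⊗ₜ 1 := by simp

/-- The action `ρ` moves the entries of `y` past elements of `B` through the exchange
homomorphisms `Θ α`, one for each column `α` of `y`. -/
def IsExchange {κ J : Type} [Fintype κ] [DecidableEq κ]
    (ρ : C →ₐ[K] Module.End K (B ⊗[K] C)) (y : Matrix κ J C) (Θ : J → B →ₐ[K] Matrix κ κ B) :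
    Prop :=
  ∀ j α f c, ρ (y j α) (f ⊗ₜ c) = ∑ k, Θ α f j k ⊗ₜ (y k α * c)

theorem commute_map_of_entries {κ J : Type} {y : Matrix κ J C}
    (hy : Algebra.adjoin K {c | ∃ j α, y j α = c} = ⊤) {Z : Module.End K (B ⊗[K] C)}
    (h : ∀ j α, Commute Z (ρ (y j α))) (c : C) : Commute Z (ρ c) := by
  refine commute_map_of_adjoin_eq_top hy ρ ?_ c
  rintro _ ⟨j, α, rfl⟩
  exact h j α

namespace IsExchange
variable {κ J : Type} [Fintype κ] [DecidableEq κ] {y : Matrix κ J C}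
  {Θ : J → B →ₐ[K] Matrix κ κ B} (hρ : IsExchange ρ y Θ)
include hρ

theorem map_tmul_mul (j : κ) (α : J) (g : B) (z : B ⊗[K] C) :
    ρ (y j α) ((g ⊗ₜ 1) * z) = ∑ k, (Θ α g j k ⊗ₜ 1) * ρ (y k α) z := by
  induction z with
  | zero => simp
  | add z w hz hw => simp only [mul_add, map_add, hz, hw, Finset.sum_add_distrib]
  | tmul f c =>
    simp only [Algebra.TensorProduct.tmul_mul_tmul, one_mul, hρ _ _ _ _, map_mul, Matrix.mul_apply,
      Finset.mul_sum, TensorProduct.sum_tmul]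
    exact Finset.sum_comm

variable (hy : Algebra.adjoin K {c | ∃ j α, y j α = c} = ⊤)
include hy

theorem map_mul_tmul (c c' : C) (z : B ⊗[K] C) : ρ c (z * (1 ⊗ₜ c')) = ρ c z * (1 ⊗ₜ c') := by
  let Z : Module.End K (B ⊗[K] C) := LinearMap.mulRight K (1 ⊗ₜ c')
  have hcomm : Commute Z (ρ c) := by
    refine commute_map_of_entries hy (fun j α => TensorProduct.ext' fun f d => ?_) c
    simp [Z, hρ _ _ _ _, mul_assoc]
  exact (LinearMap.congr_fun hcomm.eq z).symm

theorem map_one_tmul (c d : C) : ρ c (1 ⊗ₜ d) = 1 ⊗ₜ (c * d) := by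
  have hc : c ∈ Algebra.adjoin K {c | ∃ j α, y j α = c} := hy ▸ Algebra.mem_top
  induction hc using Algebra.adjoin_induction generalizing d with
  | mem x hx =>
    obtain ⟨j, α, rfl⟩ := hx
    simp [hρ _ _ _ _, Matrix.one_apply, TensorProduct.ite_tmul]
  | algebraMap k =>
    rw [AlgHom.commutes, Module.algebraMap_end_apply, ← TensorProduct.tmul_smul, Algebra.smul_def]
  | add x x' _ _ hx hx' =>
    simp only [map_add, LinearMap.add_apply, hx, hx', add_mul, TensorProduct.tmul_add]
  | mul x x' _ _ hx hx' =>
    simp only [map_mul, Module.End.mul_apply, hx, hx', mul_assoc]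

theorem twisting_tmul_one (c : C) : twisting ρ (c ⊗ₜ 1) = 1 ⊗ₜ c := by
  rw [twisting_tmul, hρ.map_one_tmul hy, mul_one]

theorem diagram1_twisting : Diagram1 (twisting ρ) := by
  refine (diagram1_iff _).2 fun c f f' => ?_
  let μ : Module.End K (B ⊗[K] C) :=
    braidedMul (twisting ρ) ∘ₗ (TensorProduct.mk K _ _).flip (f' ⊗ₜ 1)
  have hμ (g : B) (d : C) : μ (g ⊗ₜ d) = (g ⊗ₜ 1) * ρ d (f' ⊗ₜ 1) := by
    simp [μ, braidedMul_tmul, ← Algebra.TensorProduct.one_def]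
  have hcomm : Commute μ (ρ c) := by
    refine commute_map_of_entries hy (fun j α => TensorProduct.ext' fun g d => ?_) c
    simp only [Module.End.mul_apply, hμ, hρ _ _ _ _, hρ.map_tmul_mul, map_sum, map_mul]
  have h := LinearMap.congr_fun hcomm.eq (f ⊗ₜ 1)
  simp only [Module.End.mul_apply, hμ, map_one, Module.End.one_apply,
    Algebra.TensorProduct.tmul_mul_tmul, one_mul] at h
  exact h.symm

theorem diagram2_twisting : Diagram2 (twisting ρ) := by
  refine (diagram2_iff _).2 fun c c' f => ?_
  simp only [twisting_tmul, map_mul, Module.End.mul_apply]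
  induction ρ c' (f ⊗ₜ 1) with
  | zero => simp
  | add z w hz hw => simp only [TensorProduct.tmul_add, map_add, hz, hw]
  | tmul g d =>
    rw [braidedMul_tmul, ← Algebra.TensorProduct.one_def, one_mul, twisting_tmul,
      ← hρ.map_mul_tmul hy, Algebra.TensorProduct.tmul_mul_tmul, mul_one, one_mul]

end IsExchange
end Twisting

/-! ### The braiding -/

section Action
variable {r s n : ℕ}

/-- The operators on `A_{r,n} ⊗ Ā_{s,n}` by which the entries of `T̄` act. -/
def actMatrix (r s n : ℕ) : Matrix (I n) (I s) (Module.End K (A r n ⊗[K] Abar s n)) :=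
  Matrix.of fun b α => ∑ d, TensorProduct.map
    (Matrix.entryLinearMap K (A r n) b d ∘ₗ (exchangeHom (pr α)).toLinearMap)
    (LinearMap.mulLeft K (Tbar s n d α))

theorem actMatrix_tmul (b : I n) (α : I s) (f : A r n) (c : Abar s n) :
    actMatrix r s n b α (f ⊗ₜ c) = ∑ d, exchangeHom (pr α) f b d ⊗ₜ (Tbar s n d α * c) := by
  simp [actMatrix, LinearMap.sum_apply]

theorem actMatrix_opp (b : I n) (α : I s) :
    actMatrix r s n (opp b) (opp α) = actMatrix r s n b α := by
  refine TensorProduct.ext' fun f c => ?_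
  rw [actMatrix_tmul, actMatrix_tmul, ← Equiv.sum_comp (oppEquiv n)]
  simp only [oppEquiv_apply, pr_opp, exchangeHom_opp, Tbar_opp]

theorem prod21_actMatrix_tmul (u : I n × I n) (v : I s × I s) (f : A r n) (c : Abar s n) :
    prod21 (actMatrix r s n) u v (f ⊗ₜ c) =
      ∑ w, twofold (pr v.1) (pr v.2) f u w ⊗ₜ (prod21 (Tbar s n) w v * c) := by
  have hsign : ∀ u₁ u₂ v₁ v₂ w₁ w₂ : ZMod 2,
      u₁ * (v₁ + v₂) + u₂ * v₂ + (w₁ * (v₁ + v₂) + w₂ * v₂) +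
        ((w₁ + v₁) * (v₁ + v₂) + (w₂ + v₂) * v₂) = (u₁ + v₁) * (v₁ + v₂) + (u₂ + v₂) * v₂ := by
    decide
  simp only [prod21, Matrix.of_apply, LinearMap.smul_apply, Module.End.mul_apply, actMatrix_tmul,
    map_sum, Finset.smul_sum, Fintype.sum_prod_type]
  refine Finset.sum_congr rfl fun w₁ _ => Finset.sum_congr rfl fun w₂ _ => ?_
  simp only [twofold_apply, twist, smul_mul_assoc, TensorProduct.smul_tmul_smul, ← sg_add, hsign,
    mul_assoc]

theorem R_mul_prod21_actMatrix :
    baseChange (Module.End K (A r n ⊗[K] Abar s n)) (R n) * prod21 (actMatrix r s n) =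
      prod21 (actMatrix r s n) * baseChange (Module.End K (A r n ⊗[K] Abar s n)) (R s) := by
  refine Matrix.ext fun u v => TensorProduct.ext' fun f c => ?_
  let Θ := twofold (pr v.1) (pr v.2) f
  calc _ = ∑ w, (baseChange (A r n) (R n) * Θ) u w ⊗ₜ (prod21 (Tbar s n) w v * c) := by
        simp only [baseChange_mul_apply, LinearMap.sum_apply, LinearMap.smul_apply,
          prod21_actMatrix_tmul, TensorProduct.sum_tmul, Finset.smul_sum, TensorProduct.smul_tmul']
        exact Finset.sum_comm
    _ = ∑ w, (Θ * baseChange (A r n) (R n)) u w ⊗ₜ (prod21 (Tbar s n) w v * c) := by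
        rw [(commute_R_twofold _ _ f).eq]
    _ = ∑ w, Θ u w ⊗ₜ ((baseChange (Abar s n) (R n) * prod21 (Tbar s n)) w v * c) := by
        simp only [mul_baseChange_apply, baseChange_mul_apply, TensorProduct.sum_tmul,
          TensorProduct.tmul_sum, TensorProduct.smul_tmul, Finset.sum_mul, smul_mul_assoc]
        exact Finset.sum_comm
    _ = ∑ w, Θ u w ⊗ₜ ((prod21 (Tbar s n) * baseChange (Abar s n) (R s)) w v * c) := by
        rw [R_mul_prod21_Tbar]
    _ = ∑ y, R s y v • ∑ w, Θ u w ⊗ₜ (prod21 (Tbar s n) w y * c) := by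
        simp only [mul_baseChange_apply, TensorProduct.tmul_sum, TensorProduct.tmul_smul,
          Finset.sum_mul, smul_mul_assoc, Finset.smul_sum]
        exact Finset.sum_comm
    _ = ∑ y, R s y v • prod21 (actMatrix r s n) u y (f ⊗ₜ c) := by
        refine Finset.sum_congr rfl fun y _ => ?_
        by_cases h : pr y.1 + pr y.2 = pr v.1 + pr v.2
        · rw [prod21_actMatrix_tmul, twofold_congr h]
        · rw [R_apply_eq_zero h, zero_smul, zero_smul]
    _ = _ := by
        simp only [mul_baseChange_apply, LinearMap.sum_apply, LinearMap.smul_apply]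

/-- The action of `Ā_{s,n}` on `A_{r,n} ⊗ Ā_{s,n}` that extends left multiplication on the second
factor. -/
def action (r s n : ℕ) : Abar s n →ₐ[K] Module.End K (A r n ⊗[K] Abar s n) :=
  liftAbar (actMatrix r s n) actMatrix_opp R_mul_prod21_actMatrix

theorem isExchange_action :
    IsExchange (action r s n) (Tbar s n) fun α => exchangeHom (r := r) (pr α) := fun b α f c => by
  rw [action, liftAbar_Tbar, actMatrix_tmul]

/-- The map `Υ`, which sends `c ⊗ f` to the image of `f ⊗ 1` under the action of `c`. -/
def braiding (r s n : ℕ) : Abar s n ⊗[K] A r n →ₗ[K] A r n ⊗[K] Abar s n :=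
  twisting (action r s n)

theorem braiding_Tbar_tmul_T {i : I r} (hi : 0 < i.1) (b a : I n) (α : I s) :
    braiding r s n (Tbar s n b α ⊗ₜ T r n i a) = ∑ c, ∑ x,
      (sg ((pr α + 1) * pr x + pr a) * Rinv n (b, x) (a, c)) • (T r n i x ⊗ₜ Tbar s n c α) := by
  rw [braiding, twisting_tmul, isExchange_action]
  simp only [exchangeHom_T_of_pos _ hi, TensorProduct.sum_tmul, TensorProduct.smul_tmul', mul_one]

end Action

/-! ### The matrix form of the braiding and its parity -/

section MatrixForm
variable {r s n : ℕ}

theorem unsign_tmulM_Tbar_Tplus (b : I n) (i : IPos r) (α : I s) (a : I n) :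
    unsign (tmulM (leg1 (L₁ := IPos r) (Tbar s n)) (leg2 (L₁ := I s) (Tplus r n))) (b, i) (α, a) =
      sg ((pr b + pr α) * pr α + pr a) • (Tbar s n b α ⊗ₜ[K] T r n i.1 a) := by
  have hsign : ∀ b α a : ZMod 2, (α + α) * (α + a) + a * a + (b + α) * α = (b + α) * α + a := by
    decide
  rw [tmulM, unsign_superMul, Fintype.sum_eq_single (α, i)]
  · have hi : pr i = 0 := pr_of_pos i.2
    simp only [unsign, leg1, leg2, Tplus, twist, hi, Matrix.of_apply, if_true, add_zero, mul_zero,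
      zero_add, map_smul, LinearMap.smul_apply, TensorProduct.mk_apply, smul_smul, ← sg_add, hsign]
  · rintro ⟨β, j⟩ h
    rcases eq_or_ne i j with rfl | hij
    · have hβ : β ≠ α := fun hβ => h (by rw [hβ])
      simp [unsign, leg2, hβ]
    · simp [unsign, leg1, hij]

theorem unsign_rscal_Tplus_Sinv (b : I n) (i : IPos r) (c a : I n) :
    unsign (rscal (leg2 (L₁ := I n) (Tplus r n)) (Sinv n)) (b, i) (c, a) =
      ∑ x, (sg (pr x + pr c * pr a) * Rinv n (b, x) (a, c)) • T r n i.1 x := by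
  have hsign : ∀ b x : ZMod 2, (b + b) * (b + x) + (0 + x) * x = x := by decide
  rw [unsign_rscal, mul_baseChange_apply, Fintype.sum_prod_type, Fintype.sum_eq_single b]
  · have hi : pr i = 0 := pr_of_pos i.2
    refine Finset.sum_congr rfl fun x _ => ?_
    rw [unsign_Sinv_apply]
    simp only [unsign, leg2, Tplus, twist, hi, hsign, Matrix.of_apply, if_true, smul_smul]
    rw [sg_add (pr x)]
    congr 1
    ring
  · intro d hd
    simp [unsign, leg2, hd.symm]

theorem unsign_tmulM_Tplus_Sinv_Tbar (b : I n) (i : IPos r) (α : I s) (a : I n) :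
    unsign (tmulM (rscal (leg2 (L₁ := I n) (Tplus r n)) (Sinv n))
        (leg1 (L₁ := I n) (Tbar s n))) (b, i) (α, a) =
      sg ((pr b + pr α) * pr α + pr a) • ∑ c, ∑ x,
        (sg ((pr α + 1) * pr x + pr a) * Rinv n (b, x) (a, c)) •
          (T r n i.1 x ⊗ₜ[K] Tbar s n c α) := by
  have hsign : ∀ a b c x α : ZMod 2, b + x = a + c →
      x + c * a + ((c + α) * (α + a) + (a + a) * a) =
        (b + α) * α + a + ((α + 1) * x + a) := by decide
  rw [tmulM, unsign_superMul, Fintype.sum_prod_type, Finset.smul_sum]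
  refine Finset.sum_congr rfl fun c _ => ?_
  rw [Fintype.sum_eq_single a fun d hd => by simp [unsign, leg1, hd]]
  rw [unsign_rscal_Tplus_Sinv]
  simp only [unsign, leg1, Matrix.of_apply, if_true, TensorProduct.mk_apply,
    TensorProduct.sum_tmul, TensorProduct.smul_tmul_smul, Finset.smul_sum, smul_smul]
  refine Finset.sum_congr rfl fun x _ => ?_
  congr 1
  by_cases h : pr b + pr x = pr a + pr c
  · have e := congrArg sg (hsign _ _ _ _ (pr α) h)
    rw [sg_add, sg_add _ ((pr α + 1) * pr x + pr a)] at e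
    rw [twist]
    linear_combination Rinv n (b, x) (a, c) * e
  · rw [Rinv_apply_eq_zero (u := (b, x)) (v := (a, c)) h]
    ring

theorem map_braiding_tmulM :
    (tmulM (leg1 (L₁ := IPos r) (Tbar s n)) (leg2 (L₁ := I s) (Tplus r n))).map (braiding r s n) =
      tmulM (rscal (leg2 (L₁ := I n) (Tplus r n)) (Sinv n)) (leg1 (L₁ := I n) (Tbar s n)) := by
  refine unsign_injective (Matrix.ext ?_)
  rintro ⟨b, i⟩ ⟨α, a⟩
  rw [unsign_tmulM_Tplus_Sinv_Tbar, ← braiding_Tbar_tmul_T i.2, ← map_smul,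
    ← unsign_tmulM_Tbar_Tplus]
  exact (map_smul (braiding r s n) _ _).symm

end MatrixForm

section WordSpan
variable {ι B : Type} [Semiring B] [Algebra K B] {t : ι → B} {p : ι → ZMod 2}

/-- The span of the monomials of parity `ε` in elements `t j` of parity `p j`. -/
def wordSpan (t : ι → B) (p : ι → ZMod 2) (ε : ZMod 2) : Submodule K B :=
  Submodule.span K {x | ∃ w : List ι, (w.map p).sum = ε ∧ (w.map t).prod = x}

theorem one_mem_wordSpan : (1 : B) ∈ wordSpan t p 0 := Submodule.subset_span ⟨[], rfl, rfl⟩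

theorem mem_wordSpan (j : ι) : t j ∈ wordSpan t p (p j) :=
  Submodule.subset_span ⟨[j], by simp, by simp⟩

theorem mul_mem_wordSpan {δ ε : ZMod 2} {x y : B} (hx : x ∈ wordSpan t p δ)
    (hy : y ∈ wordSpan t p ε) : x * y ∈ wordSpan t p (δ + ε) := by
  have h := Submodule.mul_mem_mul hx hy
  rw [wordSpan, wordSpan, Submodule.span_mul_span] at h
  refine Submodule.span_mono ?_ h
  rintro _ ⟨_, ⟨w, hw, rfl⟩, _, ⟨w', hw', rfl⟩, rfl⟩
  exact ⟨w ++ w', by simp [hw, hw'], by simp⟩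

theorem map_apply_mem_of_mem_wordSpan {V : Type} [AddCommMonoid V] [Module K V]
    {ρ : B →ₐ[K] Module.End K V} {W : ZMod 2 → Submodule K V}
    (h : ∀ j ε, ∀ x ∈ W ε, ρ (t j) x ∈ W (p j + ε)) {δ ε : ZMod 2} {b : B}
    (hb : b ∈ wordSpan t p δ) {x : V} (hx : x ∈ W ε) : ρ b x ∈ W (δ + ε) := by
  suffices hle : wordSpan t p δ ≤ (W (δ + ε)).comap (ρ.toLinearMap.flip x) from hle hb
  refine Submodule.span_le.2 ?_
  rintro _ ⟨w, rfl, rfl⟩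
  clear hb
  change ρ (w.map t).prod x ∈ W ((w.map p).sum + ε)
  induction w with
  | nil => simpa using hx
  | cons j w ih =>
    simp only [List.map_cons, List.prod_cons, List.sum_cons, map_mul, Module.End.mul_apply,
      add_assoc]
    exact h _ _ _ ih

end WordSpan

section Parity
variable {r s n : ℕ}

theorem tmul_mem_gradeTensor {B C : Type} [AddCommMonoid B] [Module K B] [AddCommMonoid C]
    [Module K C] {P : ZMod 2 → Submodule K B} {Q : ZMod 2 → Submodule K C} {δ η : ZMod 2} {x : B}
    {y : C} (hx : x ∈ P δ) (hy : y ∈ Q η) : x ⊗ₜ[K] y ∈ gradeTensor P Q (δ + η) :=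
  Submodule.subset_span ⟨δ, η, rfl, x, hx, y, hy, rfl⟩

theorem map_mem_of_mem_gradeTensor {B C V : Type} [AddCommMonoid B] [Module K B] [AddCommMonoid C]
    [Module K C] [AddCommMonoid V] [Module K V] {P : ZMod 2 → Submodule K B}
    {Q : ZMod 2 → Submodule K C} {φ : B ⊗[K] C →ₗ[K] V} {W : ZMod 2 → Submodule K V}
    (h : ∀ δ η, ∀ x ∈ P δ, ∀ y ∈ Q η, φ (x ⊗ₜ y) ∈ W (δ + η)) {ε : ZMod 2} {z : B ⊗[K] C}
    (hz : z ∈ gradeTensor P Q ε) : φ z ∈ W ε := by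
  suffices hle : gradeTensor P Q ε ≤ (W ε).comap φ from hle hz
  refine Submodule.span_le.2 ?_
  rintro _ ⟨δ, η, rfl, x, hx, y, hy, rfl⟩
  exact h δ η x hx y hy

theorem gradeA_eq_wordSpan (ε : ZMod 2) : gradeA r n ε =
    wordSpan (fun p : I r × I n => T r n p.1 p.2) (fun p => pr p.1 + pr p.2) ε := by
  simp only [gradeA, wordSpan, Nat.cast_add, cast_par]

theorem gradeAbar_eq_wordSpan (ε : ZMod 2) : gradeAbar s n ε =
    wordSpan (fun p : I s × I n => tbar s n p.1 p.2) (fun p => pr p.1 + pr p.2) ε := by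
  simp only [gradeAbar, wordSpan, Nat.cast_add, cast_par]

theorem T_mem_gradeA (i : I r) (a : I n) : T r n i a ∈ gradeA r n (pr i + pr a) := by
  rw [gradeA_eq_wordSpan]
  exact mem_wordSpan (t := fun p : I r × I n => T r n p.1 p.2) (i, a)

theorem Tbar_mul_mem_gradeAbar (b : I n) (α : I s) {ε : ZMod 2} {c : Abar s n}
    (hc : c ∈ gradeAbar s n ε) : Tbar s n b α * c ∈ gradeAbar s n (pr α + pr b + ε) := by
  rw [gradeAbar_eq_wordSpan] at hc ⊢
  rw [Tbar, smul_mul_assoc]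
  exact Submodule.smul_mem _ _ (mul_mem_wordSpan
    (mem_wordSpan (t := fun p : I s × I n => tbar s n p.1 p.2) (α, b)) hc)

/-- The matrices of parity `ε` over the superalgebra `A_{r,n}`, for the parity `|b| + |d|` of the
matrix unit `E_{bd}`. -/
def gradeMatrix (r n : ℕ) (ε : ZMod 2) : Submodule K (Matrix (I n) (I n) (A r n)) :=
  ⨅ b, ⨅ d, (gradeA r n (ε + pr b + pr d)).comap (Matrix.entryLinearMap K (A r n) b d)

theorem mem_gradeMatrix {ε : ZMod 2} {X : Matrix (I n) (I n) (A r n)} :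
    X ∈ gradeMatrix r n ε ↔ ∀ b d, X b d ∈ gradeA r n (ε + pr b + pr d) := by
  simp [gradeMatrix]

theorem one_mem_gradeMatrix : 1 ∈ gradeMatrix r n 0 := by
  refine mem_gradeMatrix.2 fun b d => ?_
  rw [Matrix.one_apply]
  split_ifs with h
  · rw [h, zero_add, CharTwo.add_self_eq_zero, gradeA_eq_wordSpan]
    exact one_mem_wordSpan
  · exact zero_mem _

theorem mul_mem_gradeMatrix {δ ε : ZMod 2} {X Y : Matrix (I n) (I n) (A r n)}
    (hX : X ∈ gradeMatrix r n δ) (hY : Y ∈ gradeMatrix r n ε) :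
    X * Y ∈ gradeMatrix r n (δ + ε) := by
  refine mem_gradeMatrix.2 fun b d => ?_
  rw [Matrix.mul_apply]
  refine Submodule.sum_mem _ fun c _ => ?_
  have hX := mem_gradeMatrix.1 hX b c
  have hY := mem_gradeMatrix.1 hY c d
  rw [gradeA_eq_wordSpan] at hX hY ⊢
  have hsign : ∀ δ ε b c d : ZMod 2, δ + b + c + (ε + c + d) = δ + ε + b + d := by decide
  rw [← hsign δ ε (pr b) (pr c)]
  exact mul_mem_wordSpan hX hY

theorem exchangeHom_T_mem_gradeMatrix (ε : ZMod 2) (i : I r) (a : I n) :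
    exchangeHom ε (T r n i a) ∈ gradeMatrix r n (pr i + pr a) := by
  wlog hi : 0 < i.1 generalizing i a
  · have hparity : ∀ i a : ZMod 2, i + 1 + (a + 1) = i + a := by decide
    rw [← T_opp, ← hparity, ← pr_opp, ← pr_opp]
    exact this _ _ ((pos_or_opp_pos i).resolve_left hi)
  refine mem_gradeMatrix.2 fun b d => ?_
  rw [exchangeHom_T_of_pos ε hi]
  refine Submodule.sum_mem _ fun x _ => ?_
  by_cases h : pr b + pr x = pr a + pr d
  · have hparity : ∀ i a b d x : ZMod 2, b + x = a + d → i + a + b + d = i + x := by decide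
    rw [hparity _ _ _ _ _ h]
    exact Submodule.smul_mem _ _ (T_mem_gradeA i x)
  · rw [Rinv_apply_eq_zero (u := (b, x)) (v := (a, d)) h, mul_zero, zero_smul]
    exact zero_mem _

theorem exchangeHom_mem_gradeMatrix (ε : ZMod 2) {η : ZMod 2} {f : A r n} (hf : f ∈ gradeA r n η) :
    exchangeHom ε f ∈ gradeMatrix r n η := by
  rw [gradeA_eq_wordSpan] at hf
  let ρ := (Algebra.lmul K (Matrix (I n) (I n) (A r n))).comp (exchangeHom ε)
  have hρ (p : I r × I n) (δ : ZMod 2) (X : Matrix (I n) (I n) (A r n))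
      (hX : X ∈ gradeMatrix r n δ) : ρ (T r n p.1 p.2) X ∈ gradeMatrix r n (pr p.1 + pr p.2 + δ) :=
    mul_mem_gradeMatrix (exchangeHom_T_mem_gradeMatrix ε p.1 p.2) hX
  have h := map_apply_mem_of_mem_wordSpan hρ hf one_mem_gradeMatrix
  rw [add_zero] at h
  rw [← mul_one (exchangeHom ε f)]
  exact h

theorem action_tbar_mem (α : I s) (b : I n) {ε : ZMod 2} {x : A r n ⊗[K] Abar s n}
    (hx : x ∈ gradeTensor (gradeA r n) (gradeAbar s n) ε) :
    action r s n (tbar s n α b) x ∈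
      gradeTensor (gradeA r n) (gradeAbar s n) (pr α + pr b + ε) := by
  refine map_mem_of_mem_gradeTensor
    (W := fun ε => gradeTensor (gradeA r n) (gradeAbar s n) (pr α + pr b + ε))
    (fun δ η f hf c hc => ?_) hx
  have hparity : ∀ δ η b d α : ZMod 2, δ + b + d + (α + d + η) = α + b + (δ + η) := by decide
  rw [tbar_eq, map_smul, LinearMap.smul_apply, isExchange_action]
  refine Submodule.smul_mem _ _ (Submodule.sum_mem _ fun d _ => ?_)
  rw [← hparity δ η (pr b) (pr d)]
  exact tmul_mem_gradeTensor (mem_gradeMatrix.1 (exchangeHom_mem_gradeMatrix _ hf) b d)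
    (Tbar_mul_mem_gradeAbar d α hc)

theorem braiding_mem {ε : ZMod 2} {z : Abar s n ⊗[K] A r n}
    (hz : z ∈ gradeTensor (gradeAbar s n) (gradeA r n) ε) :
    braiding r s n z ∈ gradeTensor (gradeA r n) (gradeAbar s n) ε := by
  refine map_mem_of_mem_gradeTensor (fun δ η c hc f hf => ?_) hz
  have h1 : (1 : Abar s n) ∈ gradeAbar s n 0 := by
    rw [gradeAbar_eq_wordSpan]
    exact one_mem_wordSpan
  have hf1 := tmul_mem_gradeTensor hf h1
  rw [add_zero] at hf1
  rw [gradeAbar_eq_wordSpan] at hc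
  rw [braiding, twisting_tmul]
  have haction (p : I s × I n) (ε : ZMod 2) (x : A r n ⊗[K] Abar s n)
      (hx : x ∈ gradeTensor (gradeA r n) (gradeAbar s n) ε) :=
    action_tbar_mem p.1 p.2 hx
  exact map_apply_mem_of_mem_wordSpan haction hc hf1

end Parity

end QueerSuper

end

open QueerSuper in
theorem proposition3 (r s n : ℕ) :
    ∃ Υ : Abar s n ⊗[K] A r n →ₗ[K] A r n ⊗[K] Abar s n,
      Diagram1 Υ ∧ Diagram2 Υ ∧
      (∀ f : A r n, Υ (1 ⊗ₜ f) = f ⊗ₜ 1) ∧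
      (∀ g : Abar s n, Υ (g ⊗ₜ 1) = 1 ⊗ₜ g) ∧
      (tmulM (leg1 (L₁ := IPos r) (Tbar s n)) (leg2 (L₁ := I s) (Tplus r n))).map Υ =
        tmulM (rscal (leg2 (L₁ := I n) (Tplus r n)) (Sinv n)) (leg1 (L₁ := I n) (Tbar s n)) ∧
      (∀ ε : ZMod 2, ∀ z ∈ gradeTensor (gradeAbar s n) (gradeA r n) ε,
        Υ z ∈ gradeTensor (gradeA r n) (gradeAbar s n) ε) ∧
      (∀ x y z : A r n ⊗[K] Abar s n,
        braidedMul Υ (braidedMul Υ (x ⊗ₜ y) ⊗ₜ z) = braidedMul Υ (x ⊗ₜ braidedMul Υ (y ⊗ₜ z))) ∧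
      (∀ x : A r n ⊗[K] Abar s n,
        braidedMul Υ ((1 ⊗ₜ 1) ⊗ₜ x) = x ∧ braidedMul Υ (x ⊗ₜ (1 ⊗ₜ 1)) = x) := by
  have hy := adjoin_Tbar s n
  have hρ := isExchange_action (r := r) (s := s) (n := n)
  have h₁ : Diagram1 (braiding r s n) := hρ.diagram1_twisting hy
  have h₂ : Diagram2 (braiding r s n) := hρ.diagram2_twisting hy
  have hl := twisting_one_tmul (ρ := action r s n)
  have hr := hρ.twisting_tmul_one hy
  exact ⟨braiding r s n, h₁, h₂, hl, hr, map_braiding_tmulM, fun _ _ => braiding_mem,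
    braidedMul_assoc h₁ h₂, fun x => ⟨one_braidedMul hl x, braidedMul_one hr x⟩⟩
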